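/- \textbf{Theorem.} A $d$-dimensional \emph{constant-rate multi-mode system} (MMS), $d \geq 1$, is a finite set $\mathcal{M} \subseteq \mathbb{R}^d$ of modes. An infinite schedule is a sequence $\pi = (\alpha_1, m_1)(\alpha_2, m_2)\cdots$ with $\alpha_i \in \mathbb{R}_{>0}$ and $m_i \in \mathcal{M}$; it is \emph{non-Zeno} if $\sum_i \alpha_i = \infty$. From a point $x_0 \in \mathbb{R}^d$, it induces the execution $\sigma$ that visits the points $x_j := x_{j-1} + \alpha_j m_j$ at the times $\alpha_1 + \cdots + \alpha_j$ and moves linearly in between; $\sigma(\tau)$ is its position at time $\tau$. A \emph{zone} is a set $\{x \in \mathbb{R}^d : Ax \leq b\}$, represented by an integer matrix $A$ and an integer vector $b$. LTL formulas are given by $\varphi ::= \mathit{true} \mid Z \mid \neg\varphi \mid \varphi \land \varphi \mid \varphi \lor \varphi \mid \mathsf{F}\varphi \mid \mathsf{G}\varphi \mid \varphi\,\mathsf{U}\,\varphi$, where $Z$ is a zone. They are interpreted at times $\tau \geq 0$ of an execution $\sigma$: $\sigma, \tau \models Z$ iff $\sigma(\tau) \in Z$; the Boolean connectives are as usual; $\sigma,\tau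 \models \mathsf{F}\varphi$ (resp. $\mathsf{G}\varphi$) iff $\sigma,\tau' \models \varphi$ for some (resp. all) $\tau' \geq \tau$; and $\sigma,\tau \models \varphi\,\mathsf{U}\,\psi$ iff there is $\tau' \geq \tau$ with $\sigma,\tau' \models \psi$ and $\sigma,\tau'' \models \varphi$ for all $\tau'' \in [\tau,\tau')$. We write $x \models_{\mathcal{M}} \varphi$ iff some non-Zeno infinite schedule of $\mathcal{M}$ induces, from $x$, an execution $\sigma$ with $\sigma, 0 \models \varphi$. For a set $X$ of operators, $\mathrm{LTL}_{\mathrm{B}}(X)$ is the set of formulas that only use operators from $X$ and whose zones are all bounded. The \emph{model-checking problem} of $\mathrm{LTL}_{\mathrm{B}}(X)$ asks, given $d \geq 1$, a $d$-dimensional MMS $\mathcal{M}$ and a point $x$ with rational entries, and a formula $\varphi \in \mathrm{LTL}_{\mathrm{B}}(X)$ over zones of $\mathbb{R}^d$, whether $x \models_{\mathcal{M}} \varphi$. The model-checking problems of $\mathrm{LTL}_{\mathrm{B}}(\mathsf{U})$ and of $\mathrm{LTL}_{\mathrm{B}}(\mathsf{G}, \lor)$ are both undecidable: for neither is there an algorithm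 that, given (an encoding of) any such $\mathcal{M}$, $x$, $\varphi$, correctly decides whether $x \models_{\mathcal{M}} \varphi$. -/

import Mathlib

namespace MultiMode

/-! ### Constant-rate multi-mode systems, schedules and executions -/

/-- A `d`-dimensional constant-rate multi-mode system (MMS): a finite set of modes in `ℝ^d`. -/
abbrev MMS (d : ℕ) := Finset (Fin d → ℝ)

/-- An infinite schedule `(α₀, m₀) (α₁, m₁) ⋯` of `M`, with durations `αₙ > 0` and modes
`mₙ ∈ M`. -/
structure Schedule {d : ℕ} (M : MMS d) where
  dur : ℕ → ℝ
  mode : ℕ → (Fin d → ℝ)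
  dur_pos : ∀ n, 0 < dur n
  mode_mem : ∀ n, mode n ∈ M

/-- An infinite execution `x₀ I₀ x₁ I₁ ⋯` with `Iⱼ = [time j, time (j + 1)]`. -/
structure Execution (d : ℕ) where
  point : ℕ → (Fin d → ℝ)
  time : ℕ → ℝ
  time_zero : time 0 = 0
  time_strictMono : StrictMono time

namespace Execution

variable {d : ℕ}

/-- The union of the intervals of the execution. -/
def dom (σ : Execution d) : Set ℝ := ⋃ j, Set.Icc (σ.time j) (σ.time (j + 1))

/-- The affine interpolation between `point j` and `point (j + 1)` on the `j`-th interval. -/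
noncomputable def interp (σ : Execution d) (j : ℕ) (τ : ℝ) : Fin d → ℝ :=
  σ.point j +
    ((τ - σ.time j) / (σ.time (j + 1) - σ.time j)) • (σ.point (j + 1) - σ.point j)

open Classical in
/-- The value `σ(τ)`: the interpolation on any interval that contains `τ`
(see `val_eq_interp`), and a dummy value for `τ` outside of the domain. -/
noncomputable def val (σ : Execution d) (τ : ℝ) : Fin d → ℝ :=
  if h : ∃ j, τ ∈ Set.Icc (σ.time j) (σ.time (j + 1)) then σ.interp (Nat.find h) τ else 0

/-- The value of an execution does not depend on the interval used to compute it. -/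
theorem val_eq_interp (σ : Execution d) {j : ℕ} {τ : ℝ}
    (hj : τ ∈ Set.Icc (σ.time j) (σ.time (j + 1))) : σ.val τ = σ.interp j τ := by
  classical
  have h : ∃ j, τ ∈ Set.Icc (σ.time j) (σ.time (j + 1)) := ⟨j, hj⟩
  rw [val, dif_pos h]
  obtain ⟨h1, h2⟩ := Nat.find_spec h
  have hle : Nat.find h ≤ j := Nat.find_min' h hj
  generalize Nat.find h = k at h1 h2 hle
  rcases hle.eq_or_lt with rfl | hlt
  · rfl
  · have h3 : σ.time (k + 1) ≤ σ.time j := σ.time_strictMono.monotone hlt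
    have h4 : τ = σ.time (k + 1) := le_antisymm h2 (h3.trans hj.1)
    have h5 : σ.time (k + 1) = σ.time j := le_antisymm h3 (h4 ▸ hj.1)
    have h6 : k + 1 = j := σ.time_strictMono.injective h5
    subst h6
    have h7 : σ.time (k + 1) - σ.time k ≠ 0 :=
      sub_ne_zero.2 (σ.time_strictMono (Nat.lt_succ_self k)).ne'
    rw [interp, interp, h4, div_self h7]
    simp

end Execution

namespace Schedule

variable {d : ℕ} {M : MMS d}

/-- The execution induced by the schedule `π` from the point `x`. -/
noncomputable def induced (π : Schedule M) (x : Fin d → ℝ) : Execution d where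
  point n := x + ∑ i ∈ Finset.range n, π.dur i • π.mode i
  time n := ∑ i ∈ Finset.range n, π.dur i
  time_zero := by simp
  time_strictMono := strictMono_nat_of_lt_succ fun n => by
    rw [Finset.sum_range_succ]
    exact lt_add_of_pos_right _ (π.dur_pos n)

/-- The total duration of the schedule is infinite. -/
def NonZeno (π : Schedule M) : Prop :=
  Filter.Tendsto (fun n => ∑ i ∈ Finset.range n, π.dur i) Filter.atTop Filter.atTop

end Schedule

/-! ### Zones and linear temporal logic -/

/-- A presentation `A x ≤ b`, with integer coefficients, of a zone of `ℝ^d`. -/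
structure Zone (d : ℕ) where
  k : ℕ
  A : Matrix (Fin k) (Fin d) ℤ
  b : Fin k → ℤ

/-- The closed convex polytope `{x ∈ ℝ^d : A x ≤ b}`. -/
def Zone.toSet {d : ℕ} (Z : Zone d) : Set (Fin d → ℝ) :=
  {x | ∀ i, ∑ j, (Z.A i j : ℝ) * x j ≤ (Z.b i : ℝ)}

/-- LTL formulas whose atomic propositions are zones of `ℝ^d`. -/
inductive LTL (d : ℕ) where
  | tt : LTL d
  | zone (Z : Zone d) : LTL d
  | neg (φ : LTL d) : LTL d
  | and (φ ψ : LTL d) : LTL d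
  | or (φ ψ : LTL d) : LTL d
  | F (φ : LTL d) : LTL d
  | G (φ : LTL d) : LTL d
  | U (φ ψ : LTL d) : LTL d

/-- The operators of LTL. -/
inductive Op where
  | neg | and | or | F | G | U

namespace LTL

variable {d : ℕ}

/-- `Sat σ φ τ` stands for `σ, τ ⊨ φ`. Points in time range over the domain of `σ`, which is
the set of all non-negative reals if `σ` is induced by a non-Zeno schedule. -/
def Sat (σ : Execution d) : LTL d → ℝ → Prop
  | tt, _ => True
  | zone Z, τ => σ.val τ ∈ Z.toSet
  | neg φ, τ => ¬ Sat σ φ τ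
  | and φ ψ, τ => Sat σ φ τ ∧ Sat σ ψ τ
  | or φ ψ, τ => Sat σ φ τ ∨ Sat σ ψ τ
  | F φ, τ => ∃ τ' ∈ σ.dom, τ ≤ τ' ∧ Sat σ φ τ'
  | G φ, τ => ∀ τ' ∈ σ.dom, τ ≤ τ' → Sat σ φ τ'
  | U φ ψ, τ => ∃ τ' ∈ σ.dom, τ ≤ τ' ∧ Sat σ ψ τ' ∧ ∀ τ'' ∈ Set.Ico τ τ', Sat σ φ τ''

/-- The set of operators that occur in a formula. -/
def operators : LTL d → Set Op
  | tt => ∅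
  | zone _ => ∅
  | neg φ => {Op.neg} ∪ operators φ
  | and φ ψ => {Op.and} ∪ operators φ ∪ operators ψ
  | or φ ψ => {Op.or} ∪ operators φ ∪ operators ψ
  | F φ => {Op.F} ∪ operators φ
  | G φ => {Op.G} ∪ operators φ
  | U φ ψ => {Op.U} ∪ operators φ ∪ operators ψ

/-- The set of zones that occur in a formula. -/
def zones : LTL d → Set (Zone d)
  | tt => ∅
  | zone Z => {Z}
  | neg φ => zones φ
  | and φ ψ => zones φ ∪ zones ψ
  | or φ ψ => zones φ ∪ zones ψ
  | F φ => zones φ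
  | G φ => zones φ
  | U φ ψ => zones φ ∪ zones ψ

/-- The fragment `LTL_B(X)`: only operators from `X`, and only bounded zones. -/
def fragmentB (d : ℕ) (X : Set Op) : Set (LTL d) :=
  {φ | φ.operators ⊆ X ∧ ∀ Z ∈ φ.zones, Bornology.IsBounded Z.toSet}

end LTL

/-- `x ⊨_M φ`: some non-Zeno infinite schedule of `M` induces, from `x`, an execution that
satisfies `φ`. -/
def Models {d : ℕ} (M : MMS d) (x : Fin d → ℝ) (φ : LTL d) : Prop :=
  ∃ π : Schedule M, π.NonZeno ∧ LTL.Sat (π.induced x) φ 0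

/-! ### The model-checking problem and its encoding as finite words -/

/-- The point of `ℝ^d` given by a rational vector. -/
def toReal {d : ℕ} (v : Fin d → ℚ) : Fin d → ℝ := fun i => (v i : ℝ)

/-- An input of the model-checking problem, with rational data. The modes are given as a list,
in any order. -/
structure MCInput where
  d : ℕ
  one_le_d : 1 ≤ d
  modes : List (Fin d → ℚ)
  start : Fin d → ℚ
  formula : LTL d

namespace MCInput

open Classical in
/-- The MMS of an input. -/
noncomputable def mms (I : MCInput) : MMS I.d := (I.modes.map toReal).toFinset

/-- The question asked by the model-checking problem. -/
def Answer (I : MCInput) : Prop := Models I.mms (toReal I.start) I.formula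

end MCInput

/-- A rational vector is written as the list of the numerators and denominators of its
coordinates. -/
def vecCode {d : ℕ} (v : Fin d → ℚ) : List (ℤ × ℕ) :=
  List.ofFn fun i => ((v i).num, (v i).den)

/-- A zone is written as the list of its inequalities, each being the list of its coefficients
followed by its bound. -/
def Zone.code {d : ℕ} (Z : Zone d) : List (List ℤ × ℤ) :=
  List.ofFn fun i => (List.ofFn (Z.A i), Z.b i)

/-- A formula is written as a word in prefix (Polish) notation; its letters are the
numbers `0, …, 6`, for `true` and the six operators, and the codes of zones. -/
def LTL.code {d : ℕ} : LTL d → List (ℕ ⊕ List (List ℤ × ℤ))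
  | .tt => [.inl 0]
  | .zone Z => [.inr Z.code]
  | .neg φ => .inl 1 :: φ.code
  | .and φ ψ => .inl 2 :: (φ.code ++ ψ.code)
  | .or φ ψ => .inl 3 :: (φ.code ++ ψ.code)
  | .F φ => .inl 4 :: φ.code
  | .G φ => .inl 5 :: φ.code
  | .U φ ψ => .inl 6 :: (φ.code ++ ψ.code)

/-- The type of the codes of inputs: modes, starting point, formula. -/
abbrev Code := List (List (ℤ × ℕ)) × List (ℤ × ℕ) × List (ℕ ⊕ List (List ℤ × ℤ))

/-- The code of an input of the model-checking problem. -/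
def MCInput.code (I : MCInput) : Code :=
  (I.modes.map vecCode, vecCode I.start, I.formula.code)

theorem vecCode_injective {d : ℕ} : Function.Injective (vecCode (d := d)) := by
  intro v w h
  have h' := List.ofFn_injective h
  funext i
  have hi := congrFun h' i
  simp only [Prod.mk.injEq] at hi
  exact Rat.ext hi.1 hi.2

theorem Zone.code_injective {d : ℕ} : Function.Injective (Zone.code (d := d)) := by
  rintro ⟨k, A, b⟩ ⟨k', A', b'⟩ h
  have hk : k = k' := by simpa [Zone.code] using congrArg List.length h
  subst hk
  have h' := List.ofFn_injective h
  have hA : A = A' := by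
    funext i
    exact List.ofFn_injective (congrArg Prod.fst (congrFun h' i))
  have hb : b = b' := by
    funext i
    exact congrArg Prod.snd (congrFun h' i)
  rw [hA, hb]

/-- Prefix notation is uniquely readable. -/
theorem LTL.code_append_inj {d : ℕ} (φ : LTL d) :
    ∀ (ψ : LTL d) (s t : List (ℕ ⊕ List (List ℤ × ℤ))),
      φ.code ++ s = ψ.code ++ t → φ = ψ ∧ s = t := by
  induction φ with
  | tt => intro ψ s t h; cases ψ <;> simp_all [LTL.code]
  | zone Z =>
    intro ψ s t h
    cases ψ <;> simp_all [LTL.code]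
    exact Zone.code_injective h.1
  | neg φ ih =>
    intro ψ s t h
    cases ψ <;> simp [LTL.code] at h
    obtain ⟨rfl, rfl⟩ := ih _ _ _ h; simp
  | F φ ih =>
    intro ψ s t h
    cases ψ <;> simp [LTL.code] at h
    obtain ⟨rfl, rfl⟩ := ih _ _ _ h; simp
  | G φ ih =>
    intro ψ s t h
    cases ψ <;> simp [LTL.code] at h
    obtain ⟨rfl, rfl⟩ := ih _ _ _ h; simp
  | and φ₁ φ₂ ih₁ ih₂ =>
    intro ψ s t h
    cases ψ <;> simp [LTL.code] at h
    obtain ⟨rfl, h⟩ := ih₁ _ _ _ h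
    obtain ⟨rfl, rfl⟩ := ih₂ _ _ _ (List.append_cancel_left h); simp
  | or φ₁ φ₂ ih₁ ih₂ =>
    intro ψ s t h
    cases ψ <;> simp [LTL.code] at h
    obtain ⟨rfl, h⟩ := ih₁ _ _ _ h
    obtain ⟨rfl, rfl⟩ := ih₂ _ _ _ (List.append_cancel_left h); simp
  | U φ₁ φ₂ ih₁ ih₂ =>
    intro ψ s t h
    cases ψ <;> simp [LTL.code] at h
    obtain ⟨rfl, h⟩ := ih₁ _ _ _ h
    obtain ⟨rfl, rfl⟩ := ih₂ _ _ _ (List.append_cancel_left h); simp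

/-- Distinct inputs have distinct codes. -/
theorem MCInput.code_injective : Function.Injective MCInput.code := by
  rintro ⟨d, hd, M, x, φ⟩ ⟨d', hd', M', x', φ'⟩ h
  simp only [MCInput.code, Prod.mk.injEq] at h
  obtain ⟨h1, h2, h3⟩ := h
  have hdd : d = d' := by simpa [vecCode] using congrArg List.length h2
  subst hdd
  obtain rfl := List.map_injective_iff.2 vecCode_injective h1
  obtain rfl := vecCode_injective h2
  obtain rfl := (LTL.code_append_inj φ φ' [] [] (by simpa using h3)).1
  rfl

/-- The model-checking problem of `LTL_B(X)` is decidable: some computable predicate on codes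
gives the right answer on (the code of) every MMS, point and formula from `LTL_B(X)`. Nothing is
asked of the predicate on other codes. -/
def ModelCheckingDecidable (X : Set Op) : Prop :=
  ∃ p : Code → Prop, ComputablePred p ∧
    ∀ I : MCInput, I.formula ∈ LTL.fragmentB I.d X → (p I.code ↔ I.Answer)

end MultiMode

/-! Halting of a Turing machine on unary inputs is reduced to both problems. A configuration is
represented by a point of `ℝ³`: a number for the state and the symbol under the head, and the
numbers whose digits are given by the two half-tapes. Steps of the machine are then affine maps,
each guarded by linear inequalities.

Such a system of affine maps is simulated by a multi-mode system as follows. In a graph, each vertex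
has a control coordinate, a mode of an edge moves the control `1` from the source to the target, and
the zone of an edge forces the control coordinates of all other vertices to be `0`. The data `x` is
stored in one of two halves. An edge that applies an affine map has a mode for each `i`, which
empties `xᵢ` and fills the other half with the image of `xᵢ` at the rate `K`, and a last mode that
spends the remaining time. Since the zone requires `0 ≤ xᵢ ≤ K·c`, where `c` is the control that is
left at the source, all `xᵢ` are `0` when the edge has been traversed. Hence the time spent in the
`i`-th mode was exactly `xᵢ / K`, and the other half is the image of `x`. The guard of a map is
checked on a preceding edge that does not change the data and whose zone contains the guard.

That the execution stays in the zones of the edges is expressed by `𝖦 (Z₁ ∨ ⋯ ∨ Zₙ)`, which holds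
if the machine does not halt. With `𝖴` as the only operator, `(Z₁ 𝖴 (⋯ 𝖴 Zₙ)) 𝖴 H` takes the place
of the disjunction if the zones are ordered so that they are visited in this order. -/

namespace MultiMode

/-! ### A Turing machine with undecidable halting on unary inputs -/

section Undecidability

open Turing

theorem trNat_two_mul_add_one (m : ℕ) :
    PartrecToTM2.trNat (2 * m + 1) = .bit1 :: PartrecToTM2.trNat m := by
  have cast_eq_bit1 : ((2 * m + 1 : ℕ) : Num) = Num.bit1 (m : Num) := by
    rw [← Num.bit1_of_bit1 (m : Num)]
    push_cast
    ring
  rw [PartrecToTM2.trNat, PartrecToTM2.trNat, cast_eq_bit1]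
  cases (m : Num) <;> rfl

theorem trNat_two_pow_sub_one (n : ℕ) :
    PartrecToTM2.trNat (2 ^ n - 1) = List.replicate n .bit1 := by
  induction n with
  | zero => simp
  | succ n ih =>
    have two_pow_succ_sub_one : 2 ^ (n + 1) - 1 = 2 * (2 ^ n - 1) + 1 := by
      have : 1 ≤ 2 ^ n := Nat.one_le_two_pow
      omega
    rw [two_pow_succ_sub_one, trNat_two_mul_add_one, ih, List.replicate_succ]

theorem exists_partrec_leftInverse {g : ℕ → ℕ} (hg : Computable g) (hinj : g.Injective) :
    ∃ h : ℕ →. ℕ, Partrec h ∧ ∀ n, h (g n) = Part.some n := by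
  refine ⟨fun m => Nat.rfind fun n => Part.some (decide (g n = m)), Partrec.rfind ?_, fun n => ?_⟩
  · exact (Primrec.eq.decide.to_comp.comp (hg.comp Computable.snd) Computable.fst).partrec
  · refine Part.eq_some_iff.2 (Nat.mem_rfind.2 ⟨by simp, fun {m} hm => ?_⟩)
    simp [hinj.ne hm.ne]

theorem exists_partrec_dom_comp_undecidable {g : ℕ → ℕ} (hg : Computable g) (hinj : g.Injective) :
    ∃ f : ℕ →. ℕ, Partrec f ∧ ¬ ComputablePred fun n => (f (g n)).Dom := by
  obtain ⟨h, hh, h_comp_g⟩ := exists_partrec_leftInverse hg hinj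
  refine ⟨fun m => (h m).bind fun n => (Denumerable.ofNat Nat.Partrec.Code n).eval 0,
    hh.bind (Nat.Partrec.Code.eval_part.comp
      ((Computable.ofNat Nat.Partrec.Code).comp Computable.snd) (Computable.const 0)), ?_⟩
  refine fun hdec => ComputablePred.halting_problem 0 ?_
  refine (ComputablePred.computable_of_manyOneReducible
    (ManyOneReducible.mk _ Computable.encode) hdec).of_eq fun c => ?_
  simp [h_comp_g]

theorem computable_pow (b : ℕ) : Computable fun n : ℕ => b ^ n :=
  ((Primrec₂.unpaired'.1 Nat.Primrec.pow).comp (Primrec.const b) Primrec.id).to_comp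

theorem computable_two_pow_sub_one : Computable fun n : ℕ => 2 ^ n - 1 :=
  Primrec.nat_sub.to_comp.comp (computable_pow 2) (Computable.const 1)

theorem two_pow_sub_one_injective : Function.Injective fun n : ℕ => 2 ^ n - 1 := fun m n h =>
  Nat.pow_right_injective le_rfl (Nat.sub_one_cancel (by positivity) (by positivity) h)

instance : Finite PartrecToTM2.K' :=
  Finite.of_surjective ![.main, .rev, .aux, .stack] fun
    | .main => ⟨0, rfl⟩
    | .rev => ⟨1, rfl⟩
    | .aux => ⟨2, rfl⟩
    | .stack => ⟨3, rfl⟩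

theorem partrecToTM2_init_eq [Inhabited PartrecToTM2.Λ'] {c : ToPartrec.Code}
    (hdefault : (default : PartrecToTM2.Λ') = PartrecToTM2.trNormal c .halt) (v : List ℕ) :
    PartrecToTM2.init c v = TM2.init PartrecToTM2.K'.main (PartrecToTM2.trList v) := by
  rw [PartrecToTM2.init, TM2.init, hdefault]
  congr 1
  funext k
  cases k <;> simp

theorem exists_code_eval_two_pow_undecidable :
    ∃ c : ToPartrec.Code, ¬ ComputablePred fun n : ℕ => (c.eval [2 ^ n - 1]).Dom := by
  obtain ⟨f, hf, hund⟩ :=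
    exists_partrec_dom_comp_undecidable computable_two_pow_sub_one two_pow_sub_one_injective
  obtain ⟨c, hc⟩ := ToPartrec.Code.exists_code (Nat.Partrec'.part_iff₁.2 hf)
  refine ⟨c, fun hdec => hund (hdec.of_eq fun n => ?_)⟩
  have eval_eq : c.eval [2 ^ n - 1] = pure <$> f (2 ^ n - 1) := hc ⟨[2 ^ n - 1], rfl⟩
  rw [eval_eq]
  rfl

theorem exists_TM0_dom_iff_code_eval_dom (c : ToPartrec.Code) :
    ∃ (Γ Λ : Type) (_ : Inhabited Γ) (_ : Finite Γ) (_ : Inhabited Λ) (M : TM0.Machine Γ Λ)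
      (S : Finset Λ) (a s : Γ), s ≠ default ∧ TM0.Supports M ↑S ∧
      ∀ n, (StateTransition.eval (TM0.step M) (TM0.init (a :: List.replicate n s))).Dom ↔
        (c.eval [2 ^ n - 1]).Dom := by
  classical
  let _ : Inhabited PartrecToTM2.Λ' := ⟨PartrecToTM2.trNormal c .halt⟩
  have _ : Fintype PartrecToTM2.K' := Fintype.ofFinite _
  let tr : PartrecToTM2.Λ' → TM2.Stmt (fun _ : PartrecToTM2.K' => PartrecToTM2.Γ')
    PartrecToTM2.Λ' (Option PartrecToTM2.Γ') := PartrecToTM2.tr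
  let onMain (x : PartrecToTM2.Γ') : PartrecToTM2.K' → Option PartrecToTM2.Γ' :=
    Function.update (fun _ => none) .main (some x)
  refine ⟨TM2to1.Γ' PartrecToTM2.K' fun _ => PartrecToTM2.Γ', _, inferInstance, inferInstance,
    inferInstance, _, _, (true, onMain .cons), (false, onMain .bit1), fun h => ?_,
    TM1to0.tr_supports _ (TM2to1.tr_supports tr (PartrecToTM2.tr_supports c .halt)), fun n => ?_⟩
  · simpa [onMain] using congrFun (congrArg Prod.snd h) PartrecToTM2.K'.main
  have trInit_eq : TM2to1.trInit PartrecToTM2.K'.main (PartrecToTM2.trList [2 ^ n - 1]) =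
      ((true, onMain .cons) :: List.replicate n (false, onMain .bit1) :
        List (TM2to1.Γ' PartrecToTM2.K' fun _ => PartrecToTM2.Γ')) := by
    simp only [TM2to1.trInit, PartrecToTM2.trList, trNat_two_pow_sub_one, onMain,
      List.reverse_append, List.reverse_cons, List.reverse_nil, List.nil_append,
      List.reverse_replicate, List.cons_append]
    exact congrArg (List.cons _) List.map_replicate
  have TM2_dom_iff : (TM2.eval tr .main (PartrecToTM2.trList [2 ^ n - 1])).Dom ↔
      (c.eval [2 ^ n - 1]).Dom := by
    change (StateTransition.eval (TM2.step PartrecToTM2.tr) _).Dom ↔ _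
    rw [← partrecToTM2_init_eq rfl, PartrecToTM2.tr_eval]
    simp
  rw [← TM2_dom_iff, ← TM2to1.tr_eval_dom, ← TM1to0.tr_eval, trInit_eq]
  rfl

theorem exists_TM0_undecidable :
    ∃ (Γ Λ : Type) (_ : Inhabited Γ) (_ : Finite Γ) (_ : Inhabited Λ) (M : TM0.Machine Γ Λ)
      (S : Finset Λ) (a s : Γ), s ≠ default ∧ TM0.Supports M ↑S ∧
      ¬ ComputablePred fun n : ℕ =>
        (StateTransition.eval (TM0.step M) (TM0.init (a :: List.replicate n s))).Dom := by
  obtain ⟨c, hund⟩ := exists_code_eval_two_pow_undecidable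
  obtain ⟨Γ, Λ, hΓ, finiteΓ, hΛ, M, S, a, s, hs, hS, hdom⟩ := exists_TM0_dom_iff_code_eval_dom c
  exact ⟨Γ, Λ, hΓ, finiteΓ, hΛ, M, S, a, s, hs, hS, fun hdec => hund (hdec.of_eq hdom)⟩

theorem reaches_iff_exists_iterate_eq {σ : Type*} {f : σ → Option σ} {c b : σ} :
    StateTransition.Reaches f c b ↔ ∃ n, (fun c => (f c).getD c)^[n] c = b := by
  constructor
  · intro hreach
    induction hreach with
    | refl => exact ⟨0, rfl⟩
    | tail _ hstep ih =>
      obtain ⟨n, rfl⟩ := ih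
      exact ⟨n + 1, by rw [Function.iterate_succ_apply', Option.mem_def.1 hstep, Option.getD_some]⟩
  · rintro ⟨n, rfl⟩
    induction n with
    | zero => exact .refl
    | succ n ih =>
      rw [Function.iterate_succ_apply']
      cases hstep : f ((fun c => (f c).getD c)^[n] c) with
      | none => exact ih
      | some b => exact ih.tail hstep

theorem eval_dom_iff_exists_iterate_eq_none {σ : Type*} {f : σ → Option σ} {c : σ} :
    (StateTransition.eval f c).Dom ↔ ∃ n, f ((fun c => (f c).getD c)^[n] c) = none := by
  simp only [Part.dom_iff_mem, StateTransition.mem_eval, reaches_iff_exists_iterate_eq]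
  constructor
  · rintro ⟨_, ⟨n, rfl⟩, hnone⟩
    exact ⟨n, hnone⟩
  · rintro ⟨n, hnone⟩
    exact ⟨_, ⟨n, rfl⟩, hnone⟩

end Undecidability

/-! ### Executions -/

namespace Execution

variable {d : ℕ} {σ : Execution d} {τ : ℝ}

theorem nonneg_of_mem_dom (h : τ ∈ σ.dom) : 0 ≤ τ := by
  obtain ⟨j, hj⟩ := Set.mem_iUnion.1 h
  rw [← σ.time_zero]
  exact (σ.time_strictMono.monotone j.zero_le).trans hj.1

theorem exists_mem_Icc_time {m n : ℕ} (hmn : m < n) (hτ : τ ∈ Set.Icc (σ.time m) (σ.time n)) :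
    ∃ i ∈ Set.Ico m n, τ ∈ Set.Icc (σ.time i) (σ.time (i + 1)) := by
  rcases hτ.1.eq_or_lt with rfl | hlt
  · exact ⟨m, ⟨le_rfl, hmn⟩, le_rfl, (σ.time_strictMono m.lt_succ_self).le⟩
  · have hτ' : τ ∈ Set.Ioc (σ.time m) (σ.time n) := ⟨hlt, hτ.2⟩
    rw [← σ.time_strictMono.monotone.biUnion_Ico_Ioc_map_succ] at hτ'
    obtain ⟨i, hi, hτi⟩ := Set.mem_iUnion₂.1 hτ'
    exact ⟨i, hi, Set.Ioc_subset_Icc_self hτi⟩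

theorem val_mem_of_convex {S : Set (Fin d → ℝ)} (hS : Convex ℝ S) {j : ℕ}
    (hj : σ.point j ∈ S) (hj' : σ.point (j + 1) ∈ S)
    (hτ : τ ∈ Set.Icc (σ.time j) (σ.time (j + 1))) : σ.val τ ∈ S := by
  have dur_pos : 0 < σ.time (j + 1) - σ.time j := sub_pos.2 (σ.time_strictMono j.lt_succ_self)
  rw [σ.val_eq_interp hτ, interp]
  refine hS.add_smul_sub_mem hj hj' ⟨div_nonneg (sub_nonneg.2 hτ.1) dur_pos.le, ?_⟩
  rw [div_le_one dur_pos]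
  exact sub_le_sub_right hτ.2 _

end Execution

namespace Schedule

variable {d : ℕ} {M : MMS d} (π : Schedule M) (x : Fin d → ℝ)

theorem induced_time_succ (n : ℕ) :
    (π.induced x).time (n + 1) = (π.induced x).time n + π.dur n :=
  Finset.sum_range_succ _ _

theorem induced_point_succ (n : ℕ) :
    (π.induced x).point (n + 1) = (π.induced x).point n + π.dur n • π.mode n := by
  simp only [induced, Finset.sum_range_succ, add_assoc]

variable {x} in
theorem induced_val {n : ℕ} {τ : ℝ}
    (hτ : τ ∈ Set.Icc ((π.induced x).time n) ((π.induced x).time (n + 1))) :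
    (π.induced x).val τ = (π.induced x).point n + (τ - (π.induced x).time n) • π.mode n := by
  rw [Execution.val_eq_interp _ hτ, Execution.interp, induced_point_succ, induced_time_succ,
    add_sub_cancel_left, add_sub_cancel_left, smul_smul, div_mul_cancel₀ _ (π.dur_pos n).ne']

theorem induced_val_time (n : ℕ) :
    (π.induced x).val ((π.induced x).time n) = (π.induced x).point n := by
  have mem_Icc : (π.induced x).time n ∈
      Set.Icc ((π.induced x).time n) ((π.induced x).time (n + 1)) :=
    ⟨le_rfl, (π.induced x).time_strictMono.monotone n.le_succ⟩
  rw [π.induced_val mem_Icc, sub_self, zero_smul, add_zero]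

variable {π} in
theorem NonZeno.mem_dom (hπ : π.NonZeno) {τ : ℝ} (hτ : 0 ≤ τ) : τ ∈ (π.induced x).dom := by
  obtain ⟨n, hτn, hn⟩ :=
    ((hπ.eventually_ge_atTop τ).and (Filter.eventually_gt_atTop 0)).exists
  obtain ⟨i, -, hi⟩ := (π.induced x).exists_mem_Icc_time hn
    ⟨(π.induced x).time_zero.trans_le hτ, hτn⟩
  exact Set.mem_iUnion.2 ⟨i, hi⟩

end Schedule

/-! ### Graphs embedded in a multi-mode system -/

/-- A graph whose vertices are embedded as the unit vectors of `ℝ^V`, with labels on the edges: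
along an edge, the vector of data in `ℝ^δ` changes at one of the `r` given rates while the control
moves at unit speed, and the pair of both has to stay in a prescribed closed convex set. -/
structure ControlGraph (d : ℕ) (V E δ : Type*) where
  coord : V ⊕ δ ≃ Fin d
  src : E → V
  tgt : E → V
  src_ne_tgt : ∀ e, src e ≠ tgt e
  edge_inj : ∀ {e e'}, src e = src e' → tgt e = tgt e' → e = e'
  not_antiparallel : ∀ {e e'}, src e = tgt e' → tgt e ≠ src e'
  r : ℕ
  rate : E → ℕ → δ → ℝ
  region : E → Set (Fin d → ℝ)
  isClosed_region : ∀ e, IsClosed (region e)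
  convex_region : ∀ e, Convex ℝ (region e)
  control_nonneg : ∀ {e z}, z ∈ region e → ∀ v, 0 ≤ z (coord (.inl v))
  control_nonpos : ∀ {e z}, z ∈ region e → ∀ v, v ≠ src e → v ≠ tgt e → z (coord (.inl v)) ≤ 0

namespace ControlGraph

variable {d : ℕ} {V E δ : Type*} (G : ControlGraph d V E δ)

/-- The vector with the given control and data, over any type of scalars. -/
def pt {R : Type*} (c : V → R) (D : δ → R) : Fin d → R := Sum.elim c D ∘ G.coord.symm

theorem pt_comp_coord {R : Type*} (c : V → R) (D : δ → R) : G.pt c D ∘ G.coord = Sum.elim c D := by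
  simp [pt, Function.comp_assoc]

theorem pt_inl (c : V → ℝ) (D : δ → ℝ) (v : V) : G.pt c D (G.coord (.inl v)) = c v := by
  simp [pt]

theorem toReal_pt (c : V → ℚ) (D : δ → ℚ) :
    toReal (G.pt c D) = G.pt (fun v => (c v : ℝ)) fun i => (D i : ℝ) := by
  funext i
  simp only [toReal, pt, Function.comp_apply]
  cases G.coord.symm i <;> rfl

theorem pt_add_smul (c c' : V → ℝ) (D D' : δ → ℝ) (a : ℝ) :
    G.pt c D + a • G.pt c' D' = G.pt (c + a • c') (D + a • D') := by
  funext i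
  simp only [pt, Function.comp_apply, Pi.add_apply, Pi.smul_apply]
  cases G.coord.symm i <;> simp

section Endpoints

variable {G} {e e' : E} {c : V → ℝ} {D : δ → ℝ} {v : V}

theorem edge_eq_of_endpoints (hsrc : G.src e' = G.src e ∨ G.src e' = G.tgt e)
    (htgt : G.tgt e' = G.src e ∨ G.tgt e' = G.tgt e) : e' = e := by
  rcases hsrc with hsrc | hsrc <;> rcases htgt with htgt | htgt
  · exact absurd (hsrc.trans htgt.symm) (G.src_ne_tgt e')
  · exact G.edge_inj hsrc htgt
  · exact absurd htgt (G.not_antiparallel hsrc)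
  · exact absurd (hsrc.trans htgt.symm) (G.src_ne_tgt e')

theorem eq_src_or_eq_tgt_of_pos (hmem : G.pt c D ∈ G.region e) (hpos : 0 < c v) :
    v = G.src e ∨ v = G.tgt e := by
  by_contra! hne
  have := G.control_nonpos hmem v hne.1 hne.2
  rw [pt_inl] at this
  exact this.not_gt hpos

theorem edge_eq_of_pos (hmem : G.pt c D ∈ G.region e') (hsrc : 0 < c (G.src e))
    (htgt : 0 < c (G.tgt e)) : e' = e :=
  (edge_eq_of_endpoints (eq_src_or_eq_tgt_of_pos hmem hsrc)
    (eq_src_or_eq_tgt_of_pos hmem htgt)).symm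

end Endpoints

variable [DecidableEq V]

/-- The control at a vertex. -/
def atVertex (v : V) : V → ℝ := Pi.single v 1

/-- The control at a fraction `s` of an edge. -/
def onEdge (e : E) (s : ℝ) : V → ℝ := (1 - s) • Pi.single (G.src e) 1 + s • Pi.single (G.tgt e) 1

/-- The `j`-th mode of an edge. -/
def mode (e : E) (j : ℕ) : Fin d → ℝ :=
  G.pt (Pi.single (G.tgt e) 1 - Pi.single (G.src e) 1) (G.rate e j)

/-- The point reached on the edge `e`, after entering it with data `D`, by using each of its first
`n` modes for the given durations. -/
def progress (e : E) (D : δ → ℝ) (dur : ℕ → ℝ) (n : ℕ) : Fin d → ℝ :=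
  G.pt (G.onEdge e (∑ i ∈ Finset.range n, dur i)) (D + ∑ i ∈ Finset.range n, dur i • G.rate e i)

variable {G} {e e' : E} {s ε α : ℝ} {D : δ → ℝ} {dur : ℕ → ℝ} {n j : ℕ} {c : V → ℝ} {v : V}

theorem onEdge_zero : G.onEdge e 0 = atVertex (G.src e) := by simp [onEdge, atVertex]

theorem onEdge_one : G.onEdge e 1 = atVertex (G.tgt e) := by simp [onEdge, atVertex]

theorem onEdge_add :
    G.onEdge e s + α • (Pi.single (G.tgt e) 1 - Pi.single (G.src e) 1) = G.onEdge e (s + α) := by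
  simp only [onEdge]
  module

theorem onEdge_src : G.onEdge e s (G.src e) = 1 - s := by
  simp [onEdge, Pi.single_eq_of_ne (G.src_ne_tgt e)]

theorem onEdge_tgt : G.onEdge e s (G.tgt e) = s := by
  simp [onEdge, Pi.single_eq_of_ne (G.src_ne_tgt e).symm]

theorem onEdge_of_ne (hsrc : v ≠ G.src e) (htgt : v ≠ G.tgt e) : G.onEdge e s v = 0 := by
  simp [onEdge, Pi.single_eq_of_ne hsrc, Pi.single_eq_of_ne htgt]

theorem onEdge_nonneg (hs : s ∈ Set.Icc 0 1) (v : V) : 0 ≤ G.onEdge e s v := by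
  have hsub : 0 ≤ 1 - s := sub_nonneg.2 hs.2
  have hs0 : 0 ≤ s := hs.1
  simp only [onEdge, Pi.add_apply, Pi.smul_apply, Pi.single_apply, smul_eq_mul]
  positivity

theorem onEdge_le_max (hs : s ∈ Set.Icc 0 1) (v : V) : G.onEdge e s v ≤ max (1 - s) s := by
  by_cases hsrc : v = G.src e
  · rw [hsrc, onEdge_src]
    exact le_max_left _ _
  by_cases htgt : v = G.tgt e
  · rw [htgt, onEdge_tgt]
    exact le_max_right _ _
  rw [onEdge_of_ne hsrc htgt]
  exact hs.1.trans (le_max_right _ _)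

theorem pt_onEdge_add_smul_mode :
    G.pt (G.onEdge e s) D + ε • G.mode e j = G.pt (G.onEdge e (s + ε)) (D + ε • G.rate e j) := by
  rw [mode, pt_add_smul, onEdge_add]

theorem progress_zero : G.progress e D dur 0 = G.pt (atVertex (G.src e)) D := by
  simp [progress, onEdge_zero]

theorem progress_succ :
    G.progress e D dur (n + 1) = G.progress e D dur n + dur n • G.mode e n := by
  simp only [progress, pt_onEdge_add_smul_mode, Finset.sum_range_succ, add_assoc]

theorem progress_of_sum_eq_one (hsum : ∑ i ∈ Finset.range n, dur i = 1) :
    G.progress e D dur n =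
      G.pt (atVertex (G.tgt e)) (D + ∑ i ∈ Finset.range n, dur i • G.rate e i) := by
  rw [progress, hsum, onEdge_one]

theorem progress_add_smul_mode (hj : j < n) :
    G.progress e D dur n + ε • G.mode e j = G.progress e D (dur + Pi.single j ε) n := by
  rw [progress, pt_onEdge_add_smul_mode, progress]
  simp [Finset.sum_add_distrib, add_smul, Pi.single_apply, ite_smul, hj, add_assoc]

theorem edge_eq_of_pt_onEdge_mem (hmem : G.pt (G.onEdge e s) D ∈ G.region e')
    (hs : s ∈ Set.Ioo 0 1) : e' = e := by
  apply edge_eq_of_pos hmem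
  · rw [onEdge_src]
    exact sub_pos.2 hs.2
  · rw [onEdge_tgt]
    exact hs.1

theorem le_control_src_of_mem {e'' : E}
    (hmem : G.pt c D + ε • G.mode e j ∈ G.region e'') : ε ≤ c (G.src e) := by
  have := G.control_nonneg hmem (G.src e)
  rw [mode, pt_add_smul, pt_inl] at this
  simpa [Pi.single_eq_of_ne (G.src_ne_tgt e)] using this

variable (G) in
/-- The `j`-th mode of the edge `e` can be used from the point `p` for the duration `α` without
leaving the regions of the edges. -/
def CanMove (p : Fin d → ℝ) (e : E) (j : ℕ) (α : ℝ) : Prop :=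
  ∀ ε ∈ Set.Ioo 0 α, ∃ e', p + ε • G.mode e j ∈ G.region e'

namespace CanMove

theorem le_control_src (h : G.CanMove (G.pt c D) e j α) (hα : 0 < α) : α ≤ c (G.src e) := by
  by_contra! hlt
  obtain ⟨ε, hε, hεα⟩ := exists_between (max_lt hlt hα)
  obtain ⟨e', he'⟩ := h ε ⟨(le_max_right _ _).trans_lt hε, hεα⟩
  exact (le_control_src_of_mem he').not_gt ((le_max_left _ _).trans_lt hε)

theorem src_eq (h : G.CanMove (G.pt (atVertex v) D) e j α) (hα : 0 < α) : G.src e = v := by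
  by_contra hne
  have := h.le_control_src hα
  rw [atVertex, Pi.single_eq_of_ne hne] at this
  exact this.not_gt hα

theorem add_le_one (h : G.CanMove (G.pt (G.onEdge e s) D) e j α) (hα : 0 < α) : s + α ≤ 1 := by
  have := h.le_control_src hα
  rw [onEdge_src] at this
  linarith

theorem edge_eq (h : G.CanMove (G.pt (G.onEdge e s) D) e' j α) (hα : 0 < α)
    (hs : s ∈ Set.Ioo 0 1) : e' = e := by
  have le_src := h.le_control_src hα
  obtain ⟨ε, hε, hεα⟩ := exists_between hα
  obtain ⟨e'', he''⟩ := h ε ⟨hε, hεα⟩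
  rw [mode, pt_add_smul] at he''
  have control_pos : ∀ v, 0 < G.onEdge e s v ∨ v = G.tgt e' → 0 < (G.onEdge e s +
      ε • (Pi.single (G.tgt e') 1 - Pi.single (G.src e') 1 : V → ℝ)) v := by
    intro v hv
    have := onEdge_nonneg (G := G) (e := e) (Set.Ioo_subset_Icc_self hs) v
    simp only [Pi.add_apply, Pi.smul_apply, Pi.sub_apply, Pi.single_apply, smul_eq_mul]
    by_cases hsrc : v = G.src e'
    · rw [← hsrc] at le_src
      rw [if_pos hsrc, if_neg (hsrc ▸ G.src_ne_tgt e')]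
      linarith
    · rw [if_neg hsrc]
      rcases hv with hv | hv
      · split_ifs <;> linarith
      · rw [if_pos hv]
        linarith
  obtain rfl : e'' = e := edge_eq_of_pos he''
    (control_pos _ (.inl (by rw [onEdge_src]; exact sub_pos.2 hs.2)))
    (control_pos _ (.inl (by rw [onEdge_tgt]; exact hs.1)))
  refine edge_eq_of_endpoints ?_ (eq_src_or_eq_tgt_of_pos he'' (control_pos _ (.inr rfl)))
  by_contra! hne
  rw [onEdge_of_ne hne.1 hne.2] at le_src
  exact le_src.not_gt hα

theorem mem_region (h : G.CanMove (G.pt (G.onEdge e s) D) e j α) (hα : 0 < α) (hs : 0 ≤ s)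
    (hε : ε ∈ Set.Icc 0 α) : G.pt (G.onEdge e s) D + ε • G.mode e j ∈ G.region e := by
  have mem_of_mem_Ioo : Set.Ioo 0 α ⊆
      (fun ε : ℝ => G.pt (G.onEdge e s) D + ε • G.mode e j) ⁻¹' G.region e := by
    intro ε hε
    obtain ⟨e', he'⟩ := h ε hε
    have s_add_lt : s + ε < 1 := (add_lt_add_right hε.2 s).trans_le (h.add_le_one hα)
    obtain rfl : e' = e := by
      rw [pt_onEdge_add_smul_mode] at he'
      exact edge_eq_of_pt_onEdge_mem he' ⟨add_pos_of_nonneg_of_pos hs hε.1, s_add_lt⟩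
    exact he'
  have closed_preimage := (G.isClosed_region e).preimage
    (show Continuous fun ε : ℝ => G.pt (G.onEdge e s) D + ε • G.mode e j by fun_prop)
  rw [← closure_Ioo hα.ne] at hε
  exact closure_minimal mem_of_mem_Ioo closed_preimage hε

end CanMove

variable (G) in
/-- Here `Q k v D` is read as "the vertex `v` may be reached with data `D` after `k` edges": this
says that `Q` is preserved by running along an edge, each of the `r` modes of which is used for
some total duration. -/
def IsClosedUnderEdges (Q : ℕ → V → (δ → ℝ) → Prop) : Prop :=
  ∀ ⦃k e D⦄ (dur : ℕ → ℝ), Q k (G.src e) D → (∀ j, 0 ≤ dur j) →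
    ∑ j ∈ Finset.range G.r, dur j = 1 → G.progress e D dur 0 ∈ G.region e →
    G.progress e D dur G.r ∈ G.region e →
    Q (k + 1) (G.tgt e) (D + ∑ j ∈ Finset.range G.r, dur j • G.rate e j)

variable (G) in
/-- At time `t`, the point `p` lies on a path along edges from a vertex satisfying `Q`. -/
inductive OnPath (Q : ℕ → V → (δ → ℝ) → Prop) : ℝ → (Fin d → ℝ) → Prop
  | vertex {k v D} (hQ : Q k v D) : OnPath Q k (G.pt (atVertex v) D)
  | edge {k e D} {dur : ℕ → ℝ} (hQ : Q k (G.src e) D) (hregion : G.progress e D dur 0 ∈ G.region e)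
      (hdur : ∀ j, 0 ≤ dur j) (hpos : 0 < ∑ j ∈ Finset.range G.r, dur j)
      (hlt : ∑ j ∈ Finset.range G.r, dur j < 1) :
      OnPath Q (k + ∑ j ∈ Finset.range G.r, dur j) (G.progress e D dur G.r)

namespace OnPath

variable {Q : ℕ → V → (δ → ℝ) → Prop} {M : MMS d}

theorem of_sum_le_one (hQ : G.IsClosedUnderEdges Q) {k : ℕ} (hk : Q k (G.src e) D)
    (hsrc : G.progress e D dur 0 ∈ G.region e) (hdur : ∀ j, 0 ≤ dur j)
    (hpos : 0 < ∑ j ∈ Finset.range G.r, dur j) (hle : ∑ j ∈ Finset.range G.r, dur j ≤ 1)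
    (hmem : G.progress e D dur G.r ∈ G.region e) :
    G.OnPath Q (k + ∑ j ∈ Finset.range G.r, dur j) (G.progress e D dur G.r) := by
  rcases hle.lt_or_eq with hlt | heq
  · exact .edge hk hsrc hdur hpos hlt
  · have := OnPath.vertex (G := G) (hQ dur hk hdur heq hsrc hmem)
    rwa [progress_of_sum_eq_one heq, heq, ← Nat.cast_succ]

theorem along_edge (hQ : G.IsClosedUnderEdges Q) {k : ℕ} (hk : Q k (G.src e) D)
    (hsrc : G.progress e D dur 0 ∈ G.region e) (hdur : ∀ i, 0 ≤ dur i) (hj : j < G.r) (hα : 0 < α)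
    (hmove : G.CanMove (G.progress e D dur G.r) e j α) :
    G.OnPath Q (k + ∑ i ∈ Finset.range G.r, dur i + α)
      (G.progress e D dur G.r + α • G.mode e j) := by
  have sum_nonneg : 0 ≤ ∑ i ∈ Finset.range G.r, dur i := Finset.sum_nonneg fun i _ => hdur i
  have hle := hmove.add_le_one hα
  have hmem := hmove.mem_region hα sum_nonneg ⟨hα.le, le_rfl⟩
  rw [← progress, progress_add_smul_mode hj] at hmem
  have sum_add : ∑ i ∈ Finset.range G.r, (dur + Pi.single j α : ℕ → ℝ) i =
      ∑ i ∈ Finset.range G.r, dur i + α := by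
    simp [Finset.sum_add_distrib, Pi.single_apply, hj]
  rw [progress_add_smul_mode hj, add_assoc, ← sum_add]
  have add_single_nonneg : 0 ≤ dur + Pi.single j α := add_nonneg hdur (Pi.single_nonneg.2 hα.le)
  refine of_sum_le_one hQ hk ?_ add_single_nonneg (by linarith) (sum_add.trans_le hle) hmem
  rwa [progress_zero] at hsrc ⊢

theorem move (hQ : G.IsClosedUnderEdges Q) {t : ℝ} {p : Fin d → ℝ} (h : G.OnPath Q t p)
    (hj : j < G.r) (hα : 0 < α) (hmove : G.CanMove p e j α) :
    G.OnPath Q (t + α) (p + α • G.mode e j) := by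
  cases h with
  | @vertex k v D hk =>
    obtain rfl := hmove.src_eq hα
    have progress_eq : G.progress e D 0 G.r = G.pt (atVertex (G.src e)) D := by
      simp [progress, onEdge_zero]
    rw [← progress_eq] at hmove ⊢
    have hsrc := hmove.mem_region hα (by simp) ⟨le_rfl, hα.le⟩
    rw [← progress, zero_smul, add_zero, progress_eq, ← progress_zero (dur := 0)] at hsrc
    simpa using along_edge hQ hk hsrc (fun _ => le_rfl) hj hα hmove
  | edge hk hsrc hdur hpos hlt =>
    obtain rfl := hmove.edge_eq hα ⟨hpos, hlt⟩
    exact along_edge hQ hk hsrc hdur hj hα hmove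

theorem exists_vertex {t : ℝ} {p : Fin d → ℝ} (h : G.OnPath Q t p) :
    ∃ k v D, Q k v D ∧ t < k + 1 := by
  cases h with
  | vertex hk => exact ⟨_, _, _, hk, lt_add_one _⟩
  | edge hk _ _ _ hlt => exact ⟨_, _, _, hk, add_lt_add_right hlt _⟩

theorem exists_eq_of_one_le {t : ℝ} {p : Fin d → ℝ} (h : G.OnPath Q t p)
    (hv : 1 ≤ p (G.coord (.inl v))) : ∃ k D, Q k v D ∧ p = G.pt (atVertex v) D := by
  cases h with
  | @vertex k u D hk =>
    rw [pt_inl] at hv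
    obtain rfl : v = u := by
      by_contra hne
      rw [atVertex, Pi.single_eq_of_ne hne] at hv
      exact hv.not_gt one_pos
    exact ⟨k, D, hk, rfl⟩
  | edge hk _ _ hpos hlt =>
    rw [progress, pt_inl] at hv
    refine absurd (hv.trans (onEdge_le_max ⟨hpos.le, hlt.le⟩ v)) (not_le.2 (max_lt ?_ hlt))
    exact sub_lt_self _ hpos

section Execution

variable (hQ : G.IsClosedUnderEdges Q) (hM : ∀ m ∈ M, ∃ e, ∃ j < G.r, m = G.mode e j)
  {π : Schedule M} {x : Fin d → ℝ} {T : ℝ}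
  (hstay : ∀ τ ∈ (π.induced x).dom, τ < T → ∃ e, (π.induced x).val τ ∈ G.region e)
include hQ hM hstay

theorem move_in_schedule {n : ℕ} (h : G.OnPath Q ((π.induced x).time n) ((π.induced x).point n))
    (hα : 0 ≤ α) (hαn : α ≤ π.dur n) (hαT : (π.induced x).time n + α ≤ T) :
    G.OnPath Q ((π.induced x).time n + α) ((π.induced x).point n + α • π.mode n) := by
  rcases hα.eq_or_lt with rfl | hα
  · simpa using h
  obtain ⟨e, j, hj, hmode⟩ := hM _ (π.mode_mem n)
  rw [hmode]
  refine h.move hQ hj hα fun ε hε => ?_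
  have hτ : (π.induced x).time n + ε ∈
      Set.Icc ((π.induced x).time n) ((π.induced x).time (n + 1)) := by
    rw [π.induced_time_succ]
    constructor <;> linarith [hε.1, hε.2]
  have := hstay _ (Set.mem_iUnion.2 ⟨n, hτ⟩) (by linarith [hε.2])
  rwa [π.induced_val hτ, add_sub_cancel_left, hmode] at this

theorem induced_point (hx : G.OnPath Q 0 x) (n : ℕ) (hn : (π.induced x).time n ≤ T) :
    G.OnPath Q ((π.induced x).time n) ((π.induced x).point n) := by
  induction n with
  | zero => simpa [Schedule.induced] using hx
  | succ n ih =>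
    rw [π.induced_time_succ] at hn ⊢
    rw [π.induced_point_succ]
    have dur_pos := π.dur_pos n
    exact move_in_schedule hQ hM hstay (ih (by linarith)) dur_pos.le le_rfl hn

theorem induced_val (hx : G.OnPath Q 0 x) (hT : T ∈ (π.induced x).dom) :
    G.OnPath Q T ((π.induced x).val T) := by
  obtain ⟨n, hn⟩ := Set.mem_iUnion.1 hT
  have hle : T - (π.induced x).time n ≤ π.dur n := by
    have := hn.2
    rw [π.induced_time_succ] at this
    linarith
  have := move_in_schedule hQ hM hstay (induced_point hQ hM hstay hx n hn.1)
    (sub_nonneg.2 hn.1) hle (by linarith)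
  rwa [add_sub_cancel, ← π.induced_val hn] at this

end Execution

end OnPath

end ControlGraph

theorem forall_of_block_induction {r : ℕ} {p : ℕ → ℕ → Prop} (zero : p 0 0)
    (succ : ∀ k, ∀ j < r, p k j → p k (j + 1)) (next : ∀ k, p k r → p (k + 1) 0) (k : ℕ)
    {j : ℕ} (hj : j ≤ r) : p k j := by
  have block : ∀ {k j}, p k 0 → j ≤ r → p k j := by
    intro k j hk hj
    induction j with
    | zero => exact hk
    | succ j ih => exact succ k j hj (ih (Nat.le_of_succ_le hj))
  induction k generalizing j with
  | zero => exact block zero hj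
  | succ k ih => exact block (next k (ih le_rfl)) hj

namespace ControlGraph

variable {d : ℕ} {V E δ : Type*} {G : ControlGraph d V E δ} {M : MMS d}

variable (G) in
/-- An infinite path along the edges of `G`, which uses each mode of its `k`-th edge once, the
`j`-th one for the duration `dur k j`. -/
structure Path where
  edge : ℕ → E
  dur : ℕ → ℕ → ℝ
  start : δ → ℝ
  dur_pos : ∀ k, ∀ j < G.r, 0 < dur k j
  sum_dur : ∀ k, ∑ j ∈ Finset.range G.r, dur k j = 1
  tgt_edge : ∀ k, G.tgt (edge k) = G.src (edge (k + 1))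

namespace Path

theorem r_pos (P : Path G) : 0 < G.r := by
  refine Nat.pos_of_ne_zero fun hr => zero_ne_one (α := ℝ) ?_
  rw [← P.sum_dur 0, hr, Finset.range_zero, Finset.sum_empty]

variable (P : Path G)

/-- The data with which a path enters its `k`-th edge. -/
def data : ℕ → δ → ℝ
  | 0 => P.start
  | k + 1 => data k + ∑ j ∈ Finset.range G.r, P.dur k j • G.rate (P.edge k) j

variable [DecidableEq V]

/-- The point of `ℝ^d` at the beginning of the `k`-th edge of a path. -/
def vertexPt (k : ℕ) : Fin d → ℝ := G.pt (atVertex (G.src (P.edge k))) (P.data k)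

/-- The point at which a path is after the `j`-th mode of its `k`-th edge. -/
def pt (k j : ℕ) : Fin d → ℝ := G.progress (P.edge k) (P.data k) (P.dur k) j

theorem pt_zero (k : ℕ) : P.pt k 0 = P.vertexPt k := progress_zero

theorem pt_last (k : ℕ) : P.pt k G.r = P.vertexPt (k + 1) := by
  rw [pt, progress_of_sum_eq_one (P.sum_dur k), P.tgt_edge, vertexPt, data]

variable (hM : ∀ e, ∀ j < G.r, G.mode e j ∈ M)

/-- The schedule that follows a path. -/
def schedule : Schedule M where
  dur n := P.dur (n / G.r) (n % G.r)
  mode n := G.mode (P.edge (n / G.r)) (n % G.r)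
  dur_pos _ := P.dur_pos _ _ (Nat.mod_lt _ P.r_pos)
  mode_mem _ := hM _ _ (Nat.mod_lt _ P.r_pos)

/-- The execution that follows a path. -/
noncomputable def execution : Execution d := (P.schedule hM).induced (P.vertexPt 0)

variable {k j : ℕ}

theorem schedule_dur (hj : j < G.r) : (P.schedule hM).dur (k * G.r + j) = P.dur k j := by
  simp only [schedule]
  rw [mul_comm, Nat.mul_add_div P.r_pos, Nat.div_eq_of_lt hj, Nat.mul_add_mod,
    Nat.mod_eq_of_lt hj, add_zero]

theorem schedule_mode (hj : j < G.r) :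
    (P.schedule hM).mode (k * G.r + j) = G.mode (P.edge k) j := by
  simp only [schedule]
  rw [mul_comm, Nat.mul_add_div P.r_pos, Nat.div_eq_of_lt hj, Nat.mul_add_mod,
    Nat.mod_eq_of_lt hj, add_zero]

theorem execution_time (hj : j ≤ G.r) :
    (P.execution hM).time (k * G.r + j) = k + ∑ i ∈ Finset.range j, P.dur k i := by
  refine forall_of_block_induction
    (p := fun k j => (P.execution hM).time (k * G.r + j) = k + ∑ i ∈ Finset.range j, P.dur k i)
    ?_ (fun k j hj ih => ?_) (fun k ih => ?_) k hj
  · simp [Execution.time_zero]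
  · rw [← add_assoc, execution, Schedule.induced_time_succ, ← execution, ih, schedule_dur _ _ hj,
      Finset.sum_range_succ, add_assoc]
  · rw [add_zero, Nat.succ_mul, ih, P.sum_dur, Finset.sum_range_zero, add_zero, Nat.cast_succ]

theorem execution_point (hj : j ≤ G.r) : (P.execution hM).point (k * G.r + j) = P.pt k j := by
  refine forall_of_block_induction
    (p := fun k j => (P.execution hM).point (k * G.r + j) = P.pt k j)
    ?_ (fun k j hj ih => ?_) (fun k ih => ?_) k hj
  · simp [execution, Schedule.induced, pt_zero]
  · rw [← add_assoc, execution, Schedule.induced_point_succ, ← execution, ih, schedule_dur _ _ hj,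
      schedule_mode _ _ hj, pt, ← progress_succ, ← pt]
  · rw [add_zero, Nat.succ_mul, ih, pt_last, pt_zero]

theorem execution_time_mul (k : ℕ) : (P.execution hM).time (k * G.r) = k := by
  simpa using P.execution_time hM (k := k) G.r.zero_le

theorem nonZeno_schedule : (P.schedule hM).NonZeno :=
  Filter.tendsto_atTop_atTop_of_monotone (P.execution hM).time_strictMono.monotone fun b => by
    obtain ⟨k, hk⟩ := exists_nat_ge b
    exact ⟨k * G.r, hk.trans (P.execution_time_mul hM k).ge⟩

theorem mem_dom_execution {τ : ℝ} (hτ : 0 ≤ τ) : τ ∈ (P.execution hM).dom :=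
  (P.nonZeno_schedule hM).mem_dom _ hτ

theorem execution_val_natCast (k : ℕ) : (P.execution hM).val k = P.vertexPt k := by
  have := (P.schedule hM).induced_val_time (P.vertexPt 0) (k * G.r)
  rwa [← execution, execution_time_mul, ← add_zero (k * G.r), P.execution_point hM G.r.zero_le,
    pt_zero] at this

theorem execution_val_mem_region (hregion : ∀ j ≤ G.r, P.pt k j ∈ G.region (P.edge k)) {τ : ℝ}
    (hτ : τ ∈ Set.Icc (k : ℝ) (k + 1)) : (P.execution hM).val τ ∈ G.region (P.edge k) := by
  rw [← Nat.cast_succ, ← P.execution_time_mul hM k, ← P.execution_time_mul hM (k + 1),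
    Nat.succ_mul] at hτ
  obtain ⟨n, ⟨hkn, hnk⟩, hn⟩ :=
    (P.execution hM).exists_mem_Icc_time (Nat.lt_add_of_pos_right P.r_pos) hτ
  obtain ⟨j, rfl⟩ := Nat.exists_eq_add_of_le hkn
  have hj : j < G.r := Nat.lt_of_add_lt_add_left hnk
  refine (P.execution hM).val_mem_of_convex (G.convex_region _) ?_ ?_ hn
  · rw [P.execution_point hM hj.le]
    exact hregion j hj.le
  · rw [add_assoc, P.execution_point hM hj]
    exact hregion (j + 1) hj

end Path

end ControlGraph

/-! ### Chains of zones -/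

namespace LTL

variable {d : ℕ} {σ : Execution d} {Z₀ Z₁ : Zone d} {l : List (Zone d)} {τ τ' : ℝ}

/-- The formula `Z₁ ∨ (Z₂ ∨ ⋯ (Zₙ ∨ Z₀))`, for the zones `Z₁, …, Zₙ` of a list. -/
def orList (Z₀ : Zone d) : List (Zone d) → LTL d
  | [] => .zone Z₀
  | Z :: l => .or (.zone Z) (orList Z₀ l)

/-- The formula `Z₁ U (Z₂ U ⋯ (Zₙ U Z₀))`, for the zones `Z₁, …, Zₙ` of a list. -/
def untilList (Z₀ : Zone d) : List (Zone d) → LTL d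
  | [] => .zone Z₀
  | Z :: l => .U (.zone Z) (untilList Z₀ l)

theorem sat_orList : Sat σ (orList Z₀ l) τ ↔ ∃ Z ∈ Z₀ :: l, σ.val τ ∈ Z.toSet := by
  induction l with
  | nil => simp [orList, Sat]
  | cons Z l ih =>
    simp only [orList, Sat, ih, List.exists_mem_cons_iff]
    exact or_left_comm

theorem exists_mem_of_sat_untilList (h : Sat σ (untilList Z₀ l) τ) :
    ∃ Z ∈ Z₀ :: l, σ.val τ ∈ Z.toSet := by
  induction l with
  | nil => simpa [untilList, Sat] using h
  | cons Z l ih =>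
    obtain ⟨τ', -, hle, htail, hZ⟩ := h
    simp only [List.exists_mem_cons_iff] at ih ⊢
    rcases hle.eq_or_lt with rfl | hlt
    · exact or_left_comm.1 (.inr (ih htail))
    · exact .inr (.inl (hZ τ ⟨le_rfl, hlt⟩))

theorem sat_untilList_cons {Z : Zone d} (hτ' : τ' ∈ σ.dom) (hle : τ ≤ τ')
    (hZ : ∀ τ'' ∈ Set.Ico τ τ', σ.val τ'' ∈ Z.toSet) (h : Sat σ (untilList Z₀ l) τ') :
    Sat σ (untilList Z₀ (Z :: l)) τ :=
  ⟨τ', hτ', hle, h, hZ⟩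

theorem sat_untilList_append (l₁ : List (Zone d)) (hτ : τ ∈ σ.dom)
    (h : Sat σ (untilList Z₀ l) τ) : Sat σ (untilList Z₀ (l₁ ++ l)) τ := by
  induction l₁ with
  | nil => exact h
  | cons Z l₁ ih => exact sat_untilList_cons hτ le_rfl (fun _ hτ' => absurd hτ'.2 hτ'.1.not_gt) ih

theorem sat_untilList_append_of_mem {Z : Zone d} {l₁ : List (Zone d)} (hmem : Z ∈ l₁)
    (hτ : τ ∈ σ.dom) (hτ' : τ' ∈ σ.dom) (hle : τ ≤ τ')
    (hZ : ∀ τ'' ∈ Set.Ico τ τ', σ.val τ'' ∈ Z.toSet) (h : Sat σ (untilList Z₀ l) τ') :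
    Sat σ (untilList Z₀ (l₁ ++ l)) τ := by
  obtain ⟨l', l'', rfl⟩ := List.append_of_mem hmem
  rw [List.append_assoc]
  exact sat_untilList_append l' hτ (sat_untilList_cons hτ' hle hZ (sat_untilList_append l'' hτ' h))

theorem sat_untilList_of_mem (hτ : τ ∈ σ.dom) (h : σ.val τ ∈ Z₀.toSet) :
    Sat σ (untilList Z₀ l) τ := by
  simpa using sat_untilList_append l (l := []) hτ h

theorem operators_orList : (orList Z₀ l).operators ⊆ {Op.or} := by
  induction l with
  | nil => simp [orList, operators]
  | cons Z l ih => simpa [orList, operators] using ih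

theorem operators_untilList : (untilList Z₀ l).operators ⊆ {Op.U} := by
  induction l with
  | nil => simp [untilList, operators]
  | cons Z l ih => simpa [untilList, operators] using ih

theorem mem_zones_orList {Z : Zone d} : Z ∈ (orList Z₀ l).zones ↔ Z ∈ Z₀ :: l := by
  induction l with
  | nil => simp [orList, zones]
  | cons Z' l ih =>
    simp only [orList, zones, Set.mem_union, ih, List.mem_cons, Set.mem_singleton_iff]
    exact or_left_comm

theorem mem_zones_untilList {Z : Zone d} : Z ∈ (untilList Z₀ l).zones ↔ Z ∈ Z₀ :: l := by
  induction l with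
  | nil => simp [untilList, zones]
  | cons Z' l ih =>
    simp only [untilList, zones, Set.mem_union, ih, List.mem_cons, Set.mem_singleton_iff]
    exact or_left_comm

theorem orList_mem_fragmentB (h : ∀ Z ∈ Z₀ :: l, Bornology.IsBounded Z.toSet) :
    (orList Z₀ l).G ∈ fragmentB d {Op.G, Op.or} :=
  ⟨Set.insert_subset_insert operators_orList, fun Z hZ => h Z (mem_zones_orList.1 hZ)⟩

theorem untilList_mem_fragmentB (h : ∀ Z ∈ Z₀ :: l, Bornology.IsBounded Z.toSet)
    (h₁ : Bornology.IsBounded Z₁.toSet) :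
    (untilList Z₀ l).U (.zone Z₁) ∈ fragmentB d {Op.U} := by
  refine ⟨?_, ?_⟩
  · simpa [operators] using operators_untilList
  · rintro Z (hZ | rfl)
    exacts [h Z (mem_zones_untilList.1 hZ), h₁]

end LTL

/-! ### Systems of linear inequalities -/

namespace Zone

variable {d : ℕ} (Z : Zone d)

theorem isClosed_toSet : IsClosed Z.toSet := by
  simp only [toSet, Set.ofPred_forall]
  exact isClosed_iInter fun i => isClosed_le (by fun_prop) continuous_const

theorem convex_toSet : Convex ℝ Z.toSet := by
  simp only [toSet, Set.ofPred_forall]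
  refine convex_iInter fun i =>
    convex_halfSpace_le (f := fun x => _) ⟨fun x y => ?_, fun a x => ?_⟩ _
  · simp only [Pi.add_apply, mul_add, Finset.sum_add_distrib]
  · simp only [Pi.smul_apply, smul_eq_mul, Finset.mul_sum, mul_left_comm]

end Zone

/-- A linear inequality `∑ i, coeff i * x i ≤ bound`. -/
structure Ineq (ι : Type*) where
  coeff : ι → ℤ
  bound : ℤ

namespace Ineq

variable {ι : Type*} [Fintype ι] {d : ℕ}

/-- The point `x` satisfies an inequality. -/
def Holds (c : Ineq ι) (x : ι → ℝ) : Prop := ∑ i, (c.coeff i : ℝ) * x i ≤ c.bound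

/-- The zone given by a list of inequalities, whose variables are identified with the coordinates
of `ℝ^d`. -/
def zone (coord : ι ≃ Fin d) (l : List (Ineq ι)) : Zone d where
  k := l.length
  A i j := (l.get i).coeff (coord.symm j)
  b i := (l.get i).bound

theorem mem_zone {coord : ι ≃ Fin d} {l : List (Ineq ι)} {z : Fin d → ℝ} :
    z ∈ (zone coord l).toSet ↔ ∀ c ∈ l, c.Holds (z ∘ coord) := by
  have sum_eq : ∀ c : Ineq ι,
      ∑ j, (c.coeff (coord.symm j) : ℝ) * z j = ∑ i, (c.coeff i : ℝ) * (z ∘ coord) i := by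
    intro c
    simp [← coord.sum_comp]
  rw [List.forall_mem_iff_get]
  simp only [Zone.toSet, zone, Set.mem_ofPred_eq, sum_eq, Holds]

variable [DecidableEq ι]

/-- The inequality `x i ≤ b`. -/
def le (i : ι) (b : ℤ) : Ineq ι := ⟨Pi.single i 1, b⟩

/-- The inequality `b ≤ x i`. -/
def ge (i : ι) (b : ℤ) : Ineq ι := ⟨Pi.single i (-1), -b⟩

/-- The inequality `x i ≤ a * x j`. -/
def leMul (i j : ι) (a : ℤ) : Ineq ι := ⟨Pi.single i 1 - Pi.single j a, 0⟩

section

variable {i j : ι} {a b : ℤ} {x : ι → ℝ}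

theorem sum_single_mul : ∑ k, ((Pi.single i a : ι → ℤ) k : ℝ) * x k = a * x i := by
  simp [Pi.single_apply]

@[simp] theorem holds_le : (le i b).Holds x ↔ x i ≤ b := by
  simp [Holds, le, sum_single_mul]

@[simp] theorem holds_ge : (ge i b).Holds x ↔ b ≤ x i := by
  simp [Holds, ge, sum_single_mul]

@[simp] theorem holds_leMul : (leMul i j a).Holds x ↔ x i ≤ a * x j := by
  simp [Holds, leMul, sum_single_mul, sub_mul, Finset.sum_sub_distrib]

end

/-- The inequalities `x i ≤ R` and `-R ≤ x i`, for all `i`. -/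
noncomputable def box (ι : Type*) [Fintype ι] [DecidableEq ι] (R : ℕ) : List (Ineq ι) :=
  Finset.univ.toList.map (fun i => le i R) ++ Finset.univ.toList.map fun i => ge i (-R)

theorem forall_mem_box {R : ℕ} {x : ι → ℝ} :
    (∀ c ∈ box ι R, c.Holds x) ↔ ∀ i, |x i| ≤ R := by
  simp only [box, List.forall_mem_append, List.forall_mem_map, Finset.mem_toList,
    Finset.mem_univ, forall_const, holds_le, holds_ge, abs_le, Int.cast_neg, Int.cast_natCast,
    ← forall_and, and_comm]

theorem isBounded_zone_box (coord : ι ≃ Fin d) (R : ℕ) (l : List (Ineq ι)) :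
    Bornology.IsBounded (zone coord (box ι R ++ l)).toSet := by
  refine (Metric.isBounded_Icc (fun _ => -(R : ℝ)) fun _ => (R : ℝ)).subset fun z hz => ?_
  rw [mem_zone, List.forall_mem_append, forall_mem_box, coord.forall_congr_left] at hz
  simp only [Function.comp_apply, coord.apply_symm_apply, abs_le] at hz
  exact ⟨fun j => (hz.1 j).1, fun j => (hz.1 j).2⟩

end Ineq

/-! ### Pouring one half of the data into the other -/

section Pour

variable {m : ℕ}

/-- The vector `F x + b`. -/
noncomputable def affineImage (F : Matrix (Fin m) (Fin m) ℚ) (b : Fin m → ℚ) (x : Fin m → ℝ) :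
    Fin m → ℝ := fun i => ∑ j, (F i j : ℝ) * x j + b i

/-- The data that consist of `x` in the half `h` and of `0` in the other half. -/
def store (h : Bool) (x : Fin m → ℝ) : Bool × Fin m → ℝ := fun p => if p.1 = h then x p.2 else 0

/-- The rates at which the data change when the vector `x` in the half `h` is replaced by `F x + b`
in the other half: for `j < m`, the `j`-th mode drains the `j`-th coordinate at the rate `K`, and
hence has to be used for the duration `x j / K`. The mode `m` fills up the unit of time that is
needed in order to add `b`. -/
def pourRate (K : ℕ) (h : Bool) (F : Matrix (Fin m) (Fin m) ℚ) (b : Fin m → ℚ) (j : ℕ) :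
    Bool × Fin m → ℚ := fun p =>
  if p.1 = h then if p.2 = j then -K else 0
  else b p.2 + if hj : j < m then K * F p.2 ⟨j, hj⟩ else 0

variable {K : ℕ} {h : Bool} {F : Matrix (Fin m) (Fin m) ℚ} {b : Fin m → ℚ} {x : Fin m → ℝ}
  {dur : ℕ → ℝ} {n : ℕ} {i : Fin m}

theorem store_self : store h x (h, i) = x i := if_pos rfl

theorem affineImage_one_zero : affineImage 1 0 x = x := by
  funext i
  simp [affineImage, Matrix.one_apply, apply_ite (Rat.cast : ℚ → ℝ)]

theorem sum_mul_pourRate_self :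
    ∑ k ∈ Finset.range n, dur k * (pourRate K h F b k (h, i) : ℝ) =
      if (i : ℕ) < n then -(K * dur i) else 0 := by
  simp [pourRate, apply_ite (Rat.cast : ℚ → ℝ), mul_comm]

theorem sum_mul_pourRate_not (hsum : ∑ k ∈ Finset.range (m + 1), dur k = 1)
    (hx : ∀ i : Fin m, x i = K * dur i) :
    ∑ k ∈ Finset.range (m + 1), dur k * (pourRate K h F b k (!h, i) : ℝ) =
      affineImage F b x i := by
  simp only [pourRate, if_neg (Bool.not_ne_self h), Rat.cast_add, mul_add, Finset.sum_add_distrib,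
    ← Finset.sum_mul, hsum, one_mul, affineImage, add_comm (b i : ℝ), add_left_inj]
  rw [Finset.sum_range_succ, Finset.sum_range]
  simp only [Fin.is_lt, ↓reduceDIte, Fin.eta, hx, lt_irrefl, Rat.cast_mul, Rat.cast_natCast,
    Rat.cast_zero, mul_zero, add_zero]
  exact Finset.sum_congr rfl fun j _ => by ring

theorem store_add_sum_pourRate (hsum : ∑ k ∈ Finset.range (m + 1), dur k = 1)
    (hx : ∀ i : Fin m, x i = K * dur i) (p : Bool × Fin m) :
    store h x p + ∑ k ∈ Finset.range (m + 1), dur k * (pourRate K h F b k p : ℝ) =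
      store (!h) (affineImage F b x) p := by
  obtain ⟨h', i⟩ := p
  obtain rfl | rfl : h' = h ∨ h' = !h := by cases h <;> cases h' <;> simp
  · rw [sum_mul_pourRate_self, if_pos (i.isLt.trans m.lt_succ_self)]
    simp [store, hx]
  · rw [sum_mul_pourRate_not hsum hx]
    simp [store]

/-- The durations for which the `m + 1` modes are used in order to pour the vector `x`. -/
noncomputable def share (K : ℕ) (x : Fin m → ℝ) (j : ℕ) : ℝ :=
  if hj : j < m then x ⟨j, hj⟩ / K else 1 - (∑ i, x i) / K

theorem share_fin (x : Fin m → ℝ) (i : Fin m) : share K x i = x i / K := by simp [share]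

theorem sum_share (x : Fin m → ℝ) : ∑ j ∈ Finset.range (m + 1), share K x j = 1 := by
  rw [Finset.sum_range_succ, Finset.sum_range]
  simp only [share_fin, ← Finset.sum_div]
  simp [share]

variable (K x) in
/-- The vectors that can be poured with positive durations. -/
structure IsSmall : Prop where
  pos : ∀ i, 0 < x i
  sum_lt : ∑ i, x i < K

namespace IsSmall

variable (hx : IsSmall K x)
include hx

theorem capacity_pos : (0 : ℝ) < K :=
  (Finset.sum_nonneg fun i _ => (hx.pos i).le).trans_lt hx.sum_lt

theorem abs_store_le (p : Bool × Fin m) : |store h x p| ≤ K := by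
  rw [store]
  split_ifs
  · rw [abs_of_pos (hx.pos _)]
    exact (Finset.single_le_sum (fun i _ => (hx.pos i).le) (Finset.mem_univ _)).trans hx.sum_lt.le
  · simp

theorem share_pos (j : ℕ) : 0 < share K x j := by
  unfold share
  split_ifs
  · exact div_pos (hx.pos _) hx.capacity_pos
  · rw [sub_pos, div_lt_one hx.capacity_pos]
    exact hx.sum_lt

theorem eq_mul_share (i : Fin m) : x i = K * share K x i := by
  rw [share_fin, mul_div_cancel₀ _ hx.capacity_pos.ne']

theorem sum_share_mono : Monotone fun n => ∑ j ∈ Finset.range n, share K x j := fun _ _ hn =>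
  Finset.sum_le_sum_of_subset_of_nonneg (Finset.range_mono hn) fun j _ _ => (hx.share_pos j).le

theorem sum_share_le_one (hn : n ≤ m + 1) : ∑ j ∈ Finset.range n, share K x j ≤ 1 :=
  (hx.sum_share_mono hn).trans_eq (sum_share x)

theorem add_sum_share_pourRate_mem_Icc (hn : n ≤ m + 1) :
    store h x (h, i) + ∑ k ∈ Finset.range n, share K x k * (pourRate K h F b k (h, i) : ℝ) ∈
      Set.Icc 0 (K * (1 - ∑ k ∈ Finset.range n, share K x k)) := by
  have left_nonneg : 0 ≤ 1 - ∑ k ∈ Finset.range n, share K x k :=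
    sub_nonneg.2 (hx.sum_share_le_one hn)
  rw [sum_mul_pourRate_self, store_self, ← hx.eq_mul_share]
  split_ifs with hi
  · rw [add_neg_cancel]
    exact ⟨le_rfl, mul_nonneg K.cast_nonneg left_nonneg⟩
  · rw [add_zero]
    refine ⟨(hx.pos i).le, ?_⟩
    have sum_le := hx.sum_share_mono (not_lt.1 hi)
    have succ_le := hx.sum_share_le_one (n := i + 1) (by omega)
    rw [Finset.sum_range_succ] at succ_le
    rw [hx.eq_mul_share i]
    gcongr
    exact le_sub_iff_add_le'.2 ((add_le_add_left sum_le _).trans succ_le)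

end IsSmall

end Pour

/-! ### The input for a system of affine maps -/

/-- The vertices of the graph of a system of affine maps: at `first` and `second`, the current
point of the system is stored in the half `false`, respectively `true` of the data, and at
`checked t`, it is stored in the half `false` and satisfies the guard of the map `t`. -/
inductive Vertex (T : Type*) where
  | first
  | checked (t : T)
  | second
  deriving DecidableEq, Fintype

/-- The edges of the graph of a system of affine maps, which serve for checking the guard of a map,
for applying the map, and for copying the result into the other half of the data. -/
inductive Edge (T : Type*) where
  | check (t : T)
  | transfer (t : T)
  | copy
  deriving Fintype

namespace Edge

variable {T : Type*}

/-- The source of an edge. -/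
def src : Edge T → Vertex T
  | check _ => .first
  | transfer t => .checked t
  | copy => .second

/-- The target of an edge. -/
def tgt : Edge T → Vertex T
  | check t => .checked t
  | transfer _ => .second
  | copy => .first

end Edge

/-- The coordinates: control at the vertices, and data. -/
abbrev Coord (m : ℕ) (T : Type*) := Vertex T ⊕ Bool × Fin m

/-- Finitely many affine maps of `ℝ^m` (if `T` is finite) with rational coefficients, each of which
may be applied to the points that satisfy its guard. In the associated graph, only vectors with
`IsSmall capacity` can be poured. -/
structure AffineSystem (m : ℕ) (T : Type*) where
  guard : T → List (Ineq (Fin m))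
  linear : T → Matrix (Fin m) (Fin m) ℚ
  const : T → Fin m → ℚ
  capacity : ℕ

namespace AffineSystem

variable {m : ℕ} {T : Type*} (S : AffineSystem m T)

/-- The image of a point under one of the maps. -/
noncomputable def apply (t : T) (x : Fin m → ℝ) : Fin m → ℝ :=
  affineImage (S.linear t) (S.const t) x

/-- The map `t` may be applied to `x`. -/
def Enabled (t : T) (x : Fin m → ℝ) : Prop := ∀ c ∈ S.guard t, c.Holds x

/-- The points that are reached from `x₀` in a given number of steps. -/
inductive Reach (x₀ : Fin m → ℝ) : ℕ → (Fin m → ℝ) → Prop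
  | zero : Reach x₀ 0 x₀
  | succ {n x t} (hx : Reach x₀ n x) (ht : S.Enabled t x) : Reach x₀ (n + 1) (S.apply t x)

/-- The rates of change of the data along an edge. -/
def rate : Edge T → ℕ → Bool × Fin m → ℚ
  | .check _ => 0
  | .transfer t => pourRate S.capacity false (S.linear t) (S.const t)
  | .copy => pourRate S.capacity true 1 0

/-- An inequality on the half `false` of the data. -/
def onFirstHalf (c : Ineq (Fin m)) : Ineq (Coord m T) where
  coeff := Sum.elim 0 fun p => if p.1 then 0 else c.coeff p.2
  bound := c.bound

section Fintype

variable [Fintype T]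

variable (m T) in
/-- The coordinates, in some order. -/
noncomputable def coord : Coord m T ≃ Fin (Fintype.card (Coord m T)) := Fintype.equivFin _

/-- A bound for the coordinates of the points visited while pouring. -/
noncomputable def radius : ℕ :=
  S.capacity + 1 + ∑ q : Edge T × Fin (m + 1) × Bool × Fin m, ⌈|S.rate q.1 q.2.1 q.2.2|⌉₊

variable {S} {e : Edge T} {c : Vertex T → ℝ} {D : Bool × Fin m → ℝ} {x : Fin m → ℝ} {dur : ℕ → ℝ}
  {n : ℕ}

theorem holds_onFirstHalf {q : Ineq (Fin m)} :
    (onFirstHalf q).Holds (Sum.elim c D) ↔ q.Holds fun i => D (false, i) := by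
  simp [Ineq.Holds, onFirstHalf, Fintype.sum_sum_type, Fintype.sum_prod_type]

theorem forall_holds_onFirstHalf_store {H : List (Ineq (Fin m))} :
    (∀ q ∈ H.map onFirstHalf, q.Holds (Sum.elim c (store false x))) ↔ ∀ q ∈ H, q.Holds x := by
  simp only [List.forall_mem_map, holds_onFirstHalf, store_self]

theorem one_le_radius : (1 : ℝ) ≤ S.radius := by
  exact_mod_cast (Nat.le_add_left _ _).trans (Nat.le_add_right _ _)

theorem abs_rate_le {j : ℕ} (hj : j < m + 1) (p : Bool × Fin m) :
    |(S.rate e j p : ℝ)| ≤ S.radius - S.capacity := by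
  have le_sum := Finset.single_le_sum_of_canonicallyOrdered
    (f := fun q : Edge T × Fin (m + 1) × Bool × Fin m => ⌈|S.rate q.1 q.2.1 q.2.2|⌉₊)
    (Finset.mem_univ (e, ⟨j, hj⟩, p))
  have abs_le : |S.rate e j p| ≤ (S.radius : ℚ) - S.capacity := by
    rw [le_sub_iff_add_le']
    refine (add_le_add_right ((Nat.le_ceil _).trans (Nat.cast_le.2 le_sum)) _).trans ?_
    rw [radius, ← Nat.cast_add]
    exact Nat.cast_le.2 (Nat.add_le_add_right (Nat.le_succ _) _)
  exact_mod_cast abs_le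

theorem abs_add_sum_rate_le (hD : ∀ p, |D p| ≤ S.capacity) (hdur : ∀ j, 0 ≤ dur j)
    (hsum : ∑ j ∈ Finset.range n, dur j ≤ 1) (hn : n ≤ m + 1) (p : Bool × Fin m) :
    |D p + ∑ j ∈ Finset.range n, dur j * (S.rate e j p : ℝ)| ≤ S.radius := by
  have rate_bound : ∀ j ∈ Finset.range n,
      |dur j * (S.rate e j p : ℝ)| ≤ dur j * (S.radius - S.capacity) := fun j hj => by
    rw [abs_mul, abs_of_nonneg (hdur j)]
    exact mul_le_mul_of_nonneg_left
      (abs_rate_le ((Finset.mem_range.1 hj).trans_le hn) p) (hdur j)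
  have room_nonneg : (0 : ℝ) ≤ S.radius - S.capacity :=
    (abs_nonneg _).trans (abs_rate_le (e := e) m.succ_pos p)
  calc |D p + ∑ j ∈ Finset.range n, dur j * (S.rate e j p : ℝ)|
      ≤ |D p| + ∑ j ∈ Finset.range n, |dur j * (S.rate e j p : ℝ)| :=
        (abs_add_le _ _).trans (add_le_add_right (Finset.abs_sum_le_sum_abs _ _) _)
    _ ≤ S.capacity + (∑ j ∈ Finset.range n, dur j) * (S.radius - S.capacity) := by
        rw [Finset.sum_mul]
        exact add_le_add (hD p) (Finset.sum_le_sum rate_bound)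
    _ ≤ S.capacity + 1 * (S.radius - S.capacity) := by gcongr
    _ = S.radius := by ring

end Fintype

section DecidableEq

variable [DecidableEq T]

/-- The inequalities `0 ≤ x ≤ K * a` for the half `h` of the data, where `a` is the control
at `v`. -/
noncomputable def pourIneqs (K : ℕ) (h : Bool) (v : Vertex T) : List (Ineq (Coord m T)) :=
  Finset.univ.toList.map (fun i => .ge (.inr (h, i)) 0) ++
    Finset.univ.toList.map fun i => .leMul (.inr (h, i)) (.inl v) K

/-- The inequalities that link the data to the control along an edge. -/
noncomputable def dataIneqs : Edge T → List (Ineq (Coord m T))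
  | .check t => (S.guard t).map onFirstHalf
  | .transfer t => pourIneqs S.capacity false (.checked t)
  | .copy => pourIneqs S.capacity true .second

/-- Along the edge `e`, the vector in the half `h` of the data is replaced by its image under the
affine map given by `F` and `b` in the other half. -/
structure Pours (e : Edge T) (h : Bool) (F : Matrix (Fin m) (Fin m) ℚ) (b : Fin m → ℚ) : Prop where
  rate_eq : S.rate e = pourRate S.capacity h F b
  dataIneqs_eq : S.dataIneqs e = pourIneqs S.capacity h e.src

variable {S} in
theorem pours_transfer (t : T) : S.Pours (.transfer t) false (S.linear t) (S.const t) := ⟨rfl, rfl⟩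

variable {S} in
theorem pours_copy : S.Pours .copy true 1 0 := ⟨rfl, rfl⟩

end DecidableEq

variable [Fintype T] [DecidableEq T]

/-- The inequalities on the control along an edge. -/
noncomputable def controlIneqs (e : Edge T) : List (Ineq (Coord m T)) :=
  Finset.univ.toList.map (fun v => .ge (.inl v) 0) ++
    (Finset.univ.filter fun v => v ≠ e.src ∧ v ≠ e.tgt).toList.map fun v => .le (.inl v) 0

/-- The zone in which an edge is traversed. -/
noncomputable def edgeZone (e : Edge T) : Zone (Fintype.card (Coord m T)) :=
  Ineq.zone (coord m T) (Ineq.box _ S.radius ++ (controlIneqs e ++ S.dataIneqs e))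

/-- The zone of the points at the vertex `first` whose first half of the data satisfies further
inequalities. -/
noncomputable def finalZone (H : List (Ineq (Fin m))) : Zone (Fintype.card (Coord m T)) :=
  Ineq.zone (coord m T) (Ineq.box _ S.radius ++ .ge (.inl .first) 1 :: H.map onFirstHalf)

section Holds

variable {c : Vertex T → ℝ} {D : Bool × Fin m → ℝ} {e : Edge T} {h : Bool}
  {v : Vertex T} {K : ℕ}

theorem forall_mem_pourIneqs :
    (∀ q ∈ pourIneqs K h v, q.Holds (Sum.elim c D)) ↔ ∀ i, D (h, i) ∈ Set.Icc 0 (K * c v) := by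
  simp [pourIneqs, or_imp, forall_and]

theorem forall_mem_controlIneqs {z : Coord m T → ℝ} :
    (∀ q ∈ controlIneqs e, q.Holds z) ↔
      (∀ v, 0 ≤ z (.inl v)) ∧ ∀ v, v ≠ e.src → v ≠ e.tgt → z (.inl v) ≤ 0 := by
  simp only [controlIneqs, List.forall_mem_append, List.forall_mem_map, Finset.mem_toList,
    Finset.mem_univ, Finset.mem_filter, true_and, forall_const, and_imp, Ineq.holds_ge,
    Ineq.holds_le, Int.cast_zero]

theorem mem_edgeZone {z : Fin (Fintype.card (Coord m T)) → ℝ} :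
    z ∈ (S.edgeZone e).toSet ↔ (∀ i, |z (coord m T i)| ≤ S.radius) ∧
      ((∀ v, 0 ≤ z (coord m T (.inl v))) ∧
        ∀ v, v ≠ e.src → v ≠ e.tgt → z (coord m T (.inl v)) ≤ 0) ∧
      ∀ q ∈ S.dataIneqs e, q.Holds (z ∘ coord m T) := by
  rw [edgeZone, Ineq.mem_zone, List.forall_mem_append, List.forall_mem_append, Ineq.forall_mem_box,
    forall_mem_controlIneqs]
  rfl

theorem mem_finalZone {H : List (Ineq (Fin m))} {z : Fin (Fintype.card (Coord m T)) → ℝ} :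
    z ∈ (S.finalZone H).toSet ↔ (∀ i, |z (coord m T i)| ≤ S.radius) ∧
      1 ≤ z (coord m T (.inl .first)) ∧ ∀ q ∈ H.map onFirstHalf, q.Holds (z ∘ coord m T) := by
  rw [finalZone, Ineq.mem_zone, List.forall_mem_append, Ineq.forall_mem_box, List.forall_mem_cons,
    Ineq.holds_ge, Int.cast_one]
  rfl

end Holds

theorem isBounded_edgeZone (e : Edge T) : Bornology.IsBounded (S.edgeZone e).toSet :=
  Ineq.isBounded_zone_box _ _ _

theorem isBounded_finalZone (H : List (Ineq (Fin m))) :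
    Bornology.IsBounded (S.finalZone (T := T) H).toSet :=
  Ineq.isBounded_zone_box _ _ _

/-- The control graph of the system. -/
noncomputable def graph :
    ControlGraph (Fintype.card (Coord m T)) (Vertex T) (Edge T) (Bool × Fin m) where
  coord := coord m T
  src := Edge.src
  tgt := Edge.tgt
  src_ne_tgt e := by cases e <;> simp [Edge.src, Edge.tgt]
  edge_inj {e e'} := by cases e <;> cases e' <;> simp [Edge.src, Edge.tgt]
  not_antiparallel {e e'} := by cases e <;> cases e' <;> simp [Edge.src, Edge.tgt]
  r := m + 1
  rate e j p := S.rate e j p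
  region e := (S.edgeZone e).toSet
  isClosed_region e := Zone.isClosed_toSet _
  convex_region e := Zone.convex_toSet _
  control_nonneg hz := (S.mem_edgeZone.1 hz).2.1.1
  control_nonpos hz := (S.mem_edgeZone.1 hz).2.1.2

variable {S} {c : Vertex T → ℝ} {D : Bool × Fin m → ℝ} {e : Edge T} {dur : ℕ → ℝ} {n : ℕ}
  {x : Fin m → ℝ}

theorem pt_mem_edgeZone :
    S.graph.pt c D ∈ (S.edgeZone e).toSet ↔ (∀ i, |Sum.elim c D i| ≤ (S.radius : ℝ)) ∧
      ((∀ v, 0 ≤ c v) ∧ ∀ v, v ≠ e.src → v ≠ e.tgt → c v ≤ 0) ∧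
      ∀ q ∈ S.dataIneqs e, q.Holds (Sum.elim c D) := by
  have pt_coord : ∀ i, S.graph.pt c D (coord m T i) = Sum.elim c D i :=
    congrFun (S.graph.pt_comp_coord c D)
  simp only [mem_edgeZone, pt_coord, Sum.elim_inl, show S.graph.pt c D ∘ coord m T = Sum.elim c D
    from S.graph.pt_comp_coord c D]

theorem pt_mem_finalZone {H : List (Ineq (Fin m))} :
    S.graph.pt c D ∈ (S.finalZone H).toSet ↔ (∀ i, |Sum.elim c D i| ≤ (S.radius : ℝ)) ∧
      1 ≤ c .first ∧ ∀ q ∈ H.map onFirstHalf, q.Holds (Sum.elim c D) := by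
  have pt_coord : ∀ i, S.graph.pt c D (coord m T i) = Sum.elim c D i :=
    congrFun (S.graph.pt_comp_coord c D)
  simp only [mem_finalZone, pt_coord, Sum.elim_inl, show S.graph.pt c D ∘ coord m T = Sum.elim c D
    from S.graph.pt_comp_coord c D]

theorem add_sum_smul_rate_apply (p : Bool × Fin m) :
    (D + ∑ j ∈ Finset.range n, dur j • S.graph.rate e j) p =
      D p + ∑ j ∈ Finset.range n, dur j * (S.rate e j p : ℝ) := by
  simp [graph]

/-! ### Traversing an edge -/

theorem enabled_of_mem_edgeZone {t : T}
    (hmem : S.graph.pt c (store false x) ∈ (S.edgeZone (.check t)).toSet) : S.Enabled t x :=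
  forall_holds_onFirstHalf_store.1 (pt_mem_edgeZone.1 hmem).2.2

theorem add_sum_smul_rate_check (t : T) :
    D + ∑ j ∈ Finset.range n, dur j • S.graph.rate (.check t) j = D := by
  funext p
  rw [add_sum_smul_rate_apply]
  simp [rate]

namespace Pours

variable {h : Bool} {F : Matrix (Fin m) (Fin m) ℚ} {b : Fin m → ℚ} (he : S.Pours e h F b)
include he

theorem data_mem_Icc (hmem : S.graph.pt c D ∈ (S.edgeZone e).toSet) (i : Fin m) :
    D (h, i) ∈ Set.Icc 0 (S.capacity * c e.src) := by
  have := (pt_mem_edgeZone.1 hmem).2.2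
  rw [he.dataIneqs_eq] at this
  exact forall_mem_pourIneqs.1 this i

theorem add_sum_smul_rate (hsum : ∑ j ∈ Finset.range (m + 1), dur j = 1)
    (hx : ∀ i : Fin m, x i = S.capacity * dur i) :
    store h x + ∑ j ∈ Finset.range (m + 1), dur j • S.graph.rate e j =
      store (!h) (affineImage F b x) := by
  funext p
  rw [add_sum_smul_rate_apply, he.rate_eq, store_add_sum_pourRate hsum hx]

/-- At the target, the control at the source is `0`, so that the half `h` has to be empty. -/
theorem eq_mul_dur (hsum : ∑ j ∈ Finset.range (m + 1), dur j = 1)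
    (hmem : S.graph.progress e (store h x) dur (m + 1) ∈ (S.edgeZone e).toSet) (i : Fin m) :
    x i = S.capacity * dur i := by
  have empty := he.data_mem_Icc hmem i
  rw [add_sum_smul_rate_apply, he.rate_eq, sum_mul_pourRate_self, store_self,
    if_pos (i.isLt.trans m.lt_succ_self), hsum, show e.src = S.graph.src e from rfl,
    ControlGraph.onEdge_src, sub_self, mul_zero, Set.Icc_self, Set.mem_singleton_iff] at empty
  exact eq_of_sub_eq_zero empty

theorem holds_dataIneqs (hx : IsSmall S.capacity x) (hn : n ≤ m + 1) :
    ∀ q ∈ S.dataIneqs e, q.Holds (Sum.elim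
      (S.graph.onEdge e (∑ j ∈ Finset.range n, share S.capacity x j))
      (store h x + ∑ j ∈ Finset.range n, share S.capacity x j • S.graph.rate e j)) := by
  rw [he.dataIneqs_eq, forall_mem_pourIneqs]
  intro i
  rw [add_sum_smul_rate_apply, he.rate_eq, show e.src = S.graph.src e from rfl,
    ControlGraph.onEdge_src]
  exact hx.add_sum_share_pourRate_mem_Icc hn

end Pours

theorem abs_elim_onEdge_le (hD : ∀ p, |D p| ≤ S.capacity) (hdur : ∀ j, 0 ≤ dur j)
    (hsum : ∑ j ∈ Finset.range n, dur j ≤ 1) (hn : n ≤ m + 1) (i : Coord m T) :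
    |Sum.elim (S.graph.onEdge e (∑ j ∈ Finset.range n, dur j))
      (D + ∑ j ∈ Finset.range n, dur j • S.graph.rate e j) i| ≤ S.radius := by
  have hs : ∑ j ∈ Finset.range n, dur j ∈ Set.Icc 0 1 :=
    ⟨Finset.sum_nonneg fun j _ => hdur j, hsum⟩
  rcases i with v | p
  · rw [Sum.elim_inl, abs_of_nonneg (ControlGraph.onEdge_nonneg hs v)]
    exact ((ControlGraph.onEdge_le_max hs v).trans
      (max_le (sub_le_self _ hs.1) hs.2)).trans one_le_radius
  · rw [Sum.elim_inr, add_sum_smul_rate_apply]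
    exact abs_add_sum_rate_le hD hdur hsum hn p

theorem progress_mem_edgeZone (hD : ∀ p, |D p| ≤ S.capacity) (hdur : ∀ j, 0 ≤ dur j)
    (hsum : ∑ j ∈ Finset.range n, dur j ≤ 1) (hn : n ≤ m + 1)
    (hdata : ∀ q ∈ S.dataIneqs e, q.Holds (Sum.elim
      (S.graph.onEdge e (∑ j ∈ Finset.range n, dur j))
      (D + ∑ j ∈ Finset.range n, dur j • S.graph.rate e j))) :
    S.graph.progress e D dur n ∈ (S.edgeZone e).toSet :=
  pt_mem_edgeZone.2 ⟨abs_elim_onEdge_le hD hdur hsum hn,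
    ⟨ControlGraph.onEdge_nonneg (G := S.graph) ⟨Finset.sum_nonneg fun j _ => hdur j, hsum⟩,
      fun _ hsrc htgt => (ControlGraph.onEdge_of_ne hsrc htgt).le⟩, hdata⟩

end AffineSystem

theorem MCInput.mem_mms {I : MCInput} {z : Fin I.d → ℝ} :
    z ∈ I.mms ↔ ∃ v ∈ I.modes, toReal v = z := by
  simp [mms]

namespace AffineSystem

variable {m : ℕ} {T : Type*} (S : AffineSystem m T)

section Input

variable [Fintype T] [DecidableEq T]

/-- The point at the vertex `first` with the vector `x` in the first half of the data. -/
noncomputable def start (x : Fin m → ℚ) : Fin (Fintype.card (Coord m T)) → ℚ :=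
  S.graph.pt (Pi.single .first 1) fun p => if p.1 = false then x p.2 else 0

/-- The input that consists of the modes of the graph of the system, of the starting point for the
vector `x`, and of a formula. -/
noncomputable def input (x : Fin m → ℚ) (φ : LTL (Fintype.card (Coord m T))) : MCInput where
  d := Fintype.card (Coord m T)
  one_le_d := Fintype.card_pos_iff.2 ⟨.inl .first⟩
  modes := (Finset.univ.toList ×ˢ List.range (m + 1)).map fun q =>
    S.graph.pt (Pi.single q.1.tgt 1 - Pi.single q.1.src 1) (S.rate q.1 q.2)
  start := S.start x
  formula := φ

variable {x : Fin m → ℚ} {φ : LTL (Fintype.card (Coord m T))}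

theorem toReal_start_input :
    toReal (S.input x φ).start =
      S.graph.pt (ControlGraph.atVertex .first) (store false (toReal x)) := by
  refine (S.graph.toReal_pt _ _).trans (congrArg₂ _ (funext fun v => ?_) (funext fun p => ?_))
  · simp [ControlGraph.atVertex, Pi.single_apply, apply_ite (Rat.cast : ℚ → ℝ)]
  · simp [store, toReal, apply_ite (Rat.cast : ℚ → ℝ)]

theorem toReal_pt_single_sub_single (e : Edge T) (j : ℕ) :
    toReal (S.graph.pt (Pi.single e.tgt 1 - Pi.single e.src 1) (S.rate e j)) =
      S.graph.mode e j := by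
  refine (S.graph.toReal_pt _ _).trans (congrArg₂ _ (funext fun v => ?_) rfl)
  simp [Pi.single_apply, apply_ite (Rat.cast : ℚ → ℝ), graph]

theorem mem_mms_input {z : Fin (Fintype.card (Coord m T)) → ℝ} :
    z ∈ (S.input x φ).mms ↔ ∃ e, ∃ j < S.graph.r, z = S.graph.mode e j := by
  refine MCInput.mem_mms.trans ⟨?_, ?_⟩
  · rintro ⟨v, hv, rfl⟩
    obtain ⟨⟨e, j⟩, hej, rfl⟩ := List.mem_map.1 hv
    exact ⟨e, j, List.mem_range.1 (List.mem_product.1 hej).2, S.toReal_pt_single_sub_single e j⟩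
  · rintro ⟨e, j, hj, rfl⟩
    refine ⟨_, List.mem_map.2 ⟨(e, j), ?_, rfl⟩, S.toReal_pt_single_sub_single e j⟩
    exact List.mem_product.2 ⟨Finset.mem_toList.2 (Finset.mem_univ e), List.mem_range.2 hj⟩

/-- The zones in which the guards are checked, followed by those in which the maps are applied. -/
noncomputable def stepZones : List (Zone (Fintype.card (Coord m T))) :=
  Finset.univ.toList.map (fun t => S.edgeZone (.check t)) ++
    Finset.univ.toList.map fun t => S.edgeZone (.transfer t)

/-- The execution always stays in the zones of the edges. -/
noncomputable def safetyFormula : LTL (Fintype.card (Coord m T)) :=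
  (LTL.orList (S.edgeZone .copy) S.stepZones).G

/-- The execution stays in the zones of the edges until it is at the vertex `first` with data that
satisfy `H`. -/
noncomputable def reachFormula (H : List (Ineq (Fin m))) : LTL (Fintype.card (Coord m T)) :=
  (LTL.untilList (S.edgeZone .copy) S.stepZones).U (.zone (S.finalZone H))

theorem mem_cons_stepZones {Z : Zone (Fintype.card (Coord m T))} :
    Z ∈ S.edgeZone .copy :: S.stepZones ↔ ∃ e, S.edgeZone e = Z := by
  simp only [stepZones, List.mem_cons, List.mem_append, List.mem_map, Finset.mem_toList,
    Finset.mem_univ, true_and]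
  constructor
  · rintro (rfl | ⟨t, rfl⟩ | ⟨t, rfl⟩)
    exacts [⟨_, rfl⟩, ⟨_, rfl⟩, ⟨_, rfl⟩]
  · rintro ⟨t | t | _, rfl⟩
    exacts [.inr (.inl ⟨t, rfl⟩), .inr (.inr ⟨t, rfl⟩), .inl rfl]

theorem isBounded_of_mem_cons_stepZones (Z) (hZ : Z ∈ S.edgeZone .copy :: S.stepZones) :
    Bornology.IsBounded Z.toSet := by
  obtain ⟨e, rfl⟩ := S.mem_cons_stepZones.1 hZ
  exact S.isBounded_edgeZone e

theorem safetyFormula_mem_fragmentB :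
    S.safetyFormula ∈ LTL.fragmentB (Fintype.card (Coord m T)) {Op.G, Op.or} :=
  LTL.orList_mem_fragmentB S.isBounded_of_mem_cons_stepZones

theorem reachFormula_mem_fragmentB (H : List (Ineq (Fin m))) :
    S.reachFormula H ∈ LTL.fragmentB (Fintype.card (Coord m T)) {Op.U} :=
  LTL.untilList_mem_fragmentB S.isBounded_of_mem_cons_stepZones (S.isBounded_finalZone H)

end Input

/-! ### From executions to runs -/

/-- The data that may be seen at each vertex after a given number of edges. -/
inductive Stage (x₀ : Fin m → ℝ) : ℕ → Vertex T → (Bool × Fin m → ℝ) → Prop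
  | first {n x} (hx : S.Reach x₀ n x) : Stage x₀ (3 * n) .first (store false x)
  | checked {n x t} (hx : S.Reach x₀ n x) (ht : S.Enabled t x) :
      Stage x₀ (3 * n + 1) (.checked t) (store false x)
  | second {n x} (hx : S.Reach x₀ (n + 1) x) : Stage x₀ (3 * n + 2) .second (store true x)

variable {S} {x₀ : Fin m → ℝ} {k : ℕ} {D : Bool × Fin m → ℝ}

theorem Stage.exists_reach {v : Vertex T} (h : S.Stage x₀ k v D) :
    ∃ n x, k ≤ 3 * n + 1 ∧ S.Reach x₀ n x := by
  cases h with
  | first hx => exact ⟨_, _, by omega, hx⟩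
  | checked hx => exact ⟨_, _, by omega, hx⟩
  | @second n _ hx => exact ⟨_, _, by omega, hx⟩

theorem Stage.exists_reach_of_first (h : S.Stage x₀ k .first D) :
    ∃ n x, S.Reach x₀ n x ∧ D = store false x := by
  cases h with
  | first hx => exact ⟨_, _, hx, rfl⟩

variable [Fintype T] [DecidableEq T]

theorem isClosedUnderEdges_stage : S.graph.IsClosedUnderEdges (S.Stage x₀) := by
  rintro k (t | t | _) D dur (h | @⟨n, x, _, hx, ht⟩ | h) - hsum hsrc htgt
  · rw [add_sum_smul_rate_check]
    rw [ControlGraph.progress_zero] at hsrc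
    exact .checked ‹_› (enabled_of_mem_edgeZone hsrc)
  · have he := pours_transfer (S := S) t
    rw [show S.graph.r = m + 1 from rfl, he.add_sum_smul_rate hsum (he.eq_mul_dur hsum htgt)]
    exact .second (hx.succ ht)
  · have he := pours_copy (S := S)
    rw [show S.graph.r = m + 1 from rfl, he.add_sum_smul_rate hsum (he.eq_mul_dur hsum htgt),
      affineImage_one_zero]
    exact .first ‹_›

section Sound

variable {x : Fin m → ℚ} {φ : LTL (Fintype.card (Coord m T))} {π : Schedule (S.input x φ).mms}
  {τ : ℝ}

theorem onPath_induced_val (hτ : τ ∈ (π.induced (toReal (S.input x φ).start)).dom)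
    (hstay : ∀ τ' ∈ (π.induced (toReal (S.input x φ).start)).dom, τ' < τ →
      ∃ Z ∈ S.edgeZone .copy :: S.stepZones,
        (π.induced (toReal (S.input x φ).start)).val τ' ∈ Z.toSet) :
    S.graph.OnPath (S.Stage (toReal x)) τ ((π.induced (toReal (S.input x φ).start)).val τ) := by
  refine ControlGraph.OnPath.induced_val isClosedUnderEdges_stage
    (fun z hz => S.mem_mms_input.1 hz) (fun τ' hτ' hlt => ?_) ?_ hτ
  · obtain ⟨Z, hZ, hmem⟩ := hstay τ' hτ' hlt
    obtain ⟨e, rfl⟩ := S.mem_cons_stepZones.1 hZ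
    exact ⟨e, hmem⟩
  · rw [toReal_start_input, ← Nat.cast_zero (R := ℝ)]
    exact .vertex (.first .zero)

theorem exists_reach_of_answer_safety (h : (S.input x S.safetyFormula).Answer) (N : ℕ) :
    ∃ n ≥ N, ∃ y, S.Reach (toReal x) n y := by
  obtain ⟨π, hπ, hsat⟩ := h
  have hpath := onPath_induced_val (hπ.mem_dom _ (Nat.cast_nonneg (3 * N + 1))) fun τ hτ _ =>
    LTL.sat_orList.1 (hsat τ hτ (Execution.nonneg_of_mem_dom hτ))
  obtain ⟨k, v, D, hstage, hk⟩ := hpath.exists_vertex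
  obtain ⟨n, y, hkn, hy⟩ := hstage.exists_reach
  have : 3 * N + 1 < k + 1 := by exact_mod_cast hk
  exact ⟨n, by omega, y, hy⟩

theorem exists_reach_of_answer_reach {H : List (Ineq (Fin m))}
    (h : (S.input x (S.reachFormula H)).Answer) :
    ∃ n y, S.Reach (toReal x) n y ∧ ∀ c ∈ H, c.Holds y := by
  obtain ⟨π, -, τ, hτ, -, hfinal, hstay⟩ := h
  have hpath := onPath_induced_val hτ fun τ' hτ' hlt =>
    LTL.exists_mem_of_sat_untilList (hstay τ' ⟨Execution.nonneg_of_mem_dom hτ', hlt⟩)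
  obtain ⟨k, D, hstage, hval⟩ := hpath.exists_eq_of_one_le (v := Vertex.first)
    (S.mem_finalZone.1 hfinal).2.1
  obtain ⟨n, y, hy, rfl⟩ := hstage.exists_reach_of_first
  change (π.induced _).val τ ∈ _ at hfinal
  rw [hval] at hfinal
  exact ⟨n, y, hy, forall_holds_onFirstHalf_store.1 (pt_mem_finalZone.1 hfinal).2.2⟩

end Sound

end AffineSystem

/-! ### From runs to executions -/

namespace AffineSystem

variable {m : ℕ} {T : Type*} (S : AffineSystem m T)

/-- The first `N` steps of the sequence `u` of points apply the maps `t`. -/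
def IsRun (t : ℕ → T) (u : ℕ → Fin m → ℝ) (N : ℕ) : Prop :=
  ∀ n < N, S.Enabled (t n) (u n) ∧ u (n + 1) = S.apply (t n) (u n)

/-- The effect of an edge on the current point. -/
noncomputable def edgeMap : Edge T → (Fin m → ℝ) → Fin m → ℝ
  | .transfer t => S.apply t
  | _ => id

end AffineSystem

/-- The half of the data that contains the current point at a vertex. -/
def Vertex.half {T : Type*} : Vertex T → Bool
  | second => true
  | _ => false

namespace Edge

variable {T : Type*}

/-- The edges that apply the maps `t`, one after the other. -/
def ofRun (t : ℕ → T) (k : ℕ) : Edge T :=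
  match k % 3 with
  | 0 => check (t (k / 3))
  | 1 => transfer (t (k / 3))
  | _ => copy

variable (t : ℕ → T) (n : ℕ)

theorem ofRun_zero : ofRun t (3 * n) = check (t n) := by simp [ofRun]

theorem ofRun_one : ofRun t (3 * n + 1) = transfer (t n) := by
  simp [ofRun, Nat.mul_add_div]

theorem ofRun_two : ofRun t (3 * n + 2) = copy := by simp [ofRun]

theorem ofRun_three : ofRun t (3 * n + 3) = check (t (n + 1)) := ofRun_zero t (n + 1)

theorem exists_eq_mul_three_add (k : ℕ) : ∃ n, k = 3 * n ∨ k = 3 * n + 1 ∨ k = 3 * n + 2 :=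
  ⟨k / 3, by omega⟩

theorem tgt_ofRun (k : ℕ) : (ofRun t k).tgt = (ofRun t (k + 1)).src := by
  obtain ⟨n, rfl | rfl | rfl⟩ := exists_eq_mul_three_add k <;>
    simp only [ofRun_zero, ofRun_one, ofRun_two, ofRun_three, add_assoc, Nat.reduceAdd, src, tgt]

end Edge

namespace AffineSystem

variable {m : ℕ} {T : Type*} {S : AffineSystem m T} {t : ℕ → T}
  {u : ℕ → Fin m → ℝ} {N k n : ℕ} {e : Edge T} {x : Fin m → ℝ}

theorem IsRun.edgeMap_ofRun (hrun : S.IsRun t u N) (hk : k < 3 * N) :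
    S.edgeMap (Edge.ofRun t k) (u ((k + 1) / 3)) = u ((k + 2) / 3) := by
  obtain ⟨n, rfl | rfl | rfl⟩ := Edge.exists_eq_mul_three_add k
  · simp [Edge.ofRun_zero, edgeMap, Nat.mul_add_div]
  · simp [Edge.ofRun_one, edgeMap, add_assoc, Nat.mul_add_div, (hrun n (by omega)).2]
  · simp [Edge.ofRun_two, edgeMap, add_assoc, Nat.mul_add_div]

theorem IsRun.enabled_of_ofRun (hrun : S.IsRun t u N) (hk : k < 3 * N) {t' : T}
    (ht' : Edge.ofRun t k = .check t') : S.Enabled t' (u ((k + 1) / 3)) := by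
  obtain ⟨n, rfl | rfl | rfl⟩ := Edge.exists_eq_mul_three_add k
  · obtain rfl : t n = t' := by simpa [Edge.ofRun_zero] using ht'
    simpa [Nat.mul_add_div] using (hrun n (by omega)).1
  · simp [Edge.ofRun_one] at ht'
  · simp [Edge.ofRun_two] at ht'

variable [Fintype T] [DecidableEq T]

theorem progress_share_mem_edgeZone (hx : IsSmall S.capacity x)
    (henabled : ∀ t, e = .check t → S.Enabled t x) (hn : n ≤ m + 1) :
    S.graph.progress e (store e.src.half x) (share S.capacity x) n ∈ (S.edgeZone e).toSet := by
  refine progress_mem_edgeZone hx.abs_store_le (fun j => (hx.share_pos j).le)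
    (hx.sum_share_le_one hn) hn ?_
  cases e with
  | check t =>
    rw [add_sum_smul_rate_check]
    exact forall_holds_onFirstHalf_store.2 (henabled t rfl)
  | transfer t => exact (pours_transfer t).holds_dataIneqs hx hn
  | copy => exact pours_copy.holds_dataIneqs hx hn

theorem store_add_sum_share_smul_rate (hx : IsSmall S.capacity x) :
    store e.src.half x + ∑ j ∈ Finset.range (m + 1), share S.capacity x j • S.graph.rate e j =
      store e.tgt.half (S.edgeMap e x) := by
  cases e with
  | check t => exact add_sum_smul_rate_check t
  | transfer t => exact (pours_transfer t).add_sum_smul_rate (sum_share x) hx.eq_mul_share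
  | copy =>
    refine (pours_copy.add_sum_smul_rate (sum_share x) hx.eq_mul_share).trans ?_
    rw [affineImage_one_zero]
    rfl

/-- The path that applies the maps `t`, where the durations on the edges are suitable for pouring
the points `u`. -/
noncomputable def runPath (t : ℕ → T) (hu : ∀ n, IsSmall S.capacity (u n)) :
    ControlGraph.Path S.graph where
  edge := Edge.ofRun t
  dur k := share S.capacity (u ((k + 1) / 3))
  start := store false (u 0)
  dur_pos _ j _ := (hu _).share_pos j
  sum_dur _ := sum_share _
  tgt_edge := Edge.tgt_ofRun t

variable (hu : ∀ n, IsSmall S.capacity (u n))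

theorem runPath_data (hrun : S.IsRun t u N) (hk : k ≤ 3 * N) :
    (runPath t hu).data k = store (Edge.ofRun t k).src.half (u ((k + 1) / 3)) := by
  induction k with
  | zero => rfl
  | succ k ih =>
    rw [ControlGraph.Path.data, ih (Nat.le_of_succ_le hk), ← Edge.tgt_ofRun,
      ← hrun.edgeMap_ofRun hk]
    exact store_add_sum_share_smul_rate (hu _)

theorem runPath_vertexPt (hrun : S.IsRun t u N) (hn : n ≤ N) :
    (runPath t hu).vertexPt (3 * n) =
      S.graph.pt (ControlGraph.atVertex .first) (store false (u n)) := by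
  rw [ControlGraph.Path.vertexPt, runPath_data hu hrun (Nat.mul_le_mul_left 3 hn),
    show (3 * n + 1) / 3 = n by omega, Edge.ofRun_zero]
  exact congrArg (fun e => S.graph.pt (ControlGraph.atVertex (S.graph.src e)) _)
    (Edge.ofRun_zero t n)

section Execution

variable {M : MMS (Fintype.card (Coord m T))} (hM : ∀ e, ∀ j < S.graph.r, S.graph.mode e j ∈ M)
  {τ τ' : ℝ}

theorem runPath_val_mem_edgeZone (hrun : S.IsRun t u N) (hk : k < 3 * N)
    (hτ : τ ∈ Set.Icc (k : ℝ) (k + 1)) :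
    ((runPath t hu).execution hM).val τ ∈ (S.edgeZone (Edge.ofRun t k)).toSet := by
  refine (runPath t hu).execution_val_mem_region hM (fun j hj => ?_) hτ
  rw [ControlGraph.Path.pt, runPath_data hu hrun hk.le]
  exact progress_share_mem_edgeZone (hu _) (fun _ => hrun.enabled_of_ofRun hk) hj

theorem runPath_sat_safetyFormula (hrun : ∀ N, S.IsRun t u N) :
    LTL.Sat ((runPath t hu).execution hM) S.safetyFormula 0 := by
  intro τ _ hτ
  refine LTL.sat_orList.2 ⟨_, S.mem_cons_stepZones.2 ⟨_, rfl⟩, runPath_val_mem_edgeZone hu hM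
    (hrun (⌊τ⌋₊ + 1)) (k := ⌊τ⌋₊) (by omega) ⟨Nat.floor_le hτ, (Nat.lt_floor_add_one τ).le⟩⟩

theorem mem_dom_runPath (hτ : (k : ℝ) ≤ τ) : τ ∈ ((runPath t hu).execution hM).dom :=
  (runPath t hu).mem_dom_execution hM (k.cast_nonneg.trans hτ)

theorem runPath_sat_untilList_of_copy (hrun : S.IsRun t u N) (hk : k < 3 * N)
    (hτ : τ ∈ Set.Icc (k : ℝ) (k + 1)) (hcopy : Edge.ofRun t k = .copy)
    (l : List (Zone (Fintype.card (Coord m T)))) :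
    LTL.Sat ((runPath t hu).execution hM) (LTL.untilList (S.edgeZone .copy) l) τ :=
  LTL.sat_untilList_of_mem (mem_dom_runPath hu hM hτ.1)
    (hcopy ▸ runPath_val_mem_edgeZone hu hM hrun hk hτ)

theorem runPath_sat_untilList_append (hrun : S.IsRun t u N) (hk : k < 3 * N)
    (hτ : τ ∈ Set.Icc (k : ℝ) (k + 1)) {Z₀ : Zone (Fintype.card (Coord m T))}
    {l₁ l₂ : List (Zone (Fintype.card (Coord m T)))} (hmem : S.edgeZone (Edge.ofRun t k) ∈ l₁)
    (hnext : LTL.Sat ((runPath t hu).execution hM) (LTL.untilList Z₀ l₂) (k + 1)) :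
    LTL.Sat ((runPath t hu).execution hM) (LTL.untilList Z₀ (l₁ ++ l₂)) τ :=
  LTL.sat_untilList_append_of_mem hmem (mem_dom_runPath hu hM hτ.1)
    (mem_dom_runPath hu hM (le_add_of_nonneg_right zero_le_one)) hτ.2
    (fun _ hτ' => runPath_val_mem_edgeZone hu hM hrun hk ⟨hτ.1.trans hτ'.1, hτ'.2.le⟩) hnext

theorem runPath_sat_untilList (hrun : S.IsRun t u N) (hk : k < 3 * N)
    (hτ : τ ∈ Set.Icc (k : ℝ) (k + 1)) :
    LTL.Sat ((runPath t hu).execution hM) (LTL.untilList (S.edgeZone .copy) S.stepZones) τ := by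
  have sat_copy {n τ} (hn : n < N)
      (hτ : τ ∈ Set.Icc ((3 * n + 2 : ℕ) : ℝ) ((3 * n + 2 : ℕ) + 1)) :=
    runPath_sat_untilList_of_copy hu hM hrun (by omega) hτ (Edge.ofRun_two t n)
  have sat_transfer {n τ} (hn : n < N)
      (hτ : τ ∈ Set.Icc ((3 * n + 1 : ℕ) : ℝ) ((3 * n + 1 : ℕ) + 1)) :=
    List.append_nil (Finset.univ.toList.map fun t => S.edgeZone (.transfer t)) ▸
      runPath_sat_untilList_append hu hM hrun (by omega) hτ
        (List.mem_map.2 ⟨t n, Finset.mem_toList.2 (Finset.mem_univ _), by rw [Edge.ofRun_one]⟩)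
        (sat_copy hn (by simp [add_assoc, one_add_one_eq_two]) [])
  obtain ⟨n, rfl | rfl | rfl⟩ := Edge.exists_eq_mul_three_add k
  · refine runPath_sat_untilList_append hu hM hrun hk hτ
      (List.mem_map.2 ⟨t n, Finset.mem_toList.2 (Finset.mem_univ _), by rw [Edge.ofRun_zero]⟩) ?_
    exact sat_transfer (n := n) (by omega) (by simp)
  · exact LTL.sat_untilList_append _ (mem_dom_runPath hu hM hτ.1) (sat_transfer (by omega) hτ)
  · exact sat_copy (by omega) hτ _

theorem runPath_sat_reachFormula (hrun : S.IsRun t u N) {H : List (Ineq (Fin m))}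
    (hH : ∀ q ∈ H, q.Holds (u N)) :
    LTL.Sat ((runPath t hu).execution hM) (S.reachFormula H) 0 := by
  refine ⟨(3 * N : ℕ), mem_dom_runPath hu hM le_rfl, Nat.cast_nonneg _, ?_, fun τ hτ => ?_⟩
  · change _ ∈ (S.finalZone H).toSet
    rw [ControlGraph.Path.execution_val_natCast, runPath_vertexPt hu hrun le_rfl]
    refine pt_mem_finalZone.2 ⟨?_, ?_, forall_holds_onFirstHalf_store.2 hH⟩
    · simpa [ControlGraph.onEdge_zero, graph, Edge.src] using
        abs_elim_onEdge_le (e := .check (t 0)) (dur := 0) (n := 0) (hu N).abs_store_le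
          (fun _ => le_rfl) (by simp) (Nat.zero_le _)
    · simp [ControlGraph.atVertex]
  · exact runPath_sat_untilList hu hM hrun ((Nat.floor_lt hτ.1).2 hτ.2)
      ⟨Nat.floor_le hτ.1, (Nat.lt_floor_add_one τ).le⟩

end Execution

variable {x : Fin m → ℚ}

theorem answer_of_runPath_sat {φ : LTL (Fintype.card (Coord m T))} (hx : u 0 = toReal x)
    (hsat : ∀ hM : ∀ e, ∀ j < S.graph.r, S.graph.mode e j ∈ (S.input x φ).mms,
      LTL.Sat ((runPath t hu).execution hM) φ 0) : (S.input x φ).Answer := by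
  have hM : ∀ e, ∀ j < S.graph.r, S.graph.mode e j ∈ (S.input x φ).mms := fun e j hj =>
    S.mem_mms_input.2 ⟨e, j, hj, rfl⟩
  have start_eq : toReal (S.input x φ).start = (runPath t hu).vertexPt 0 := by
    rw [toReal_start_input, ← hx]
    rfl
  refine ⟨(runPath t hu).schedule hM, (runPath t hu).nonZeno_schedule hM, ?_⟩
  rw [start_eq]
  exact hsat hM

end AffineSystem

/-! ### Simulation of partial functions -/

namespace AffineSystem

variable {m : ℕ} {T : Type*} {S : AffineSystem m T}

/-- The runs of the system from the points `enc c`, where `c` satisfies the invariant `I`,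
correspond to the iterations of `f`, and `H` expresses that there is no next iteration. -/
structure Simulates {σ : Type*} (S : AffineSystem m T) (f : σ → Option σ) (enc : σ → Fin m → ℚ)
    (I : σ → Prop) (H : List (Ineq (Fin m))) : Prop where
  mem_of_mem_step {c c'} : I c → c' ∈ f c → I c'
  isSmall {c} : I c → IsSmall S.capacity (toReal (enc c))
  step_of_enabled {c t} : I c → S.Enabled t (toReal (enc c)) →
    ∃ c' ∈ f c, toReal (enc c') = S.apply t (toReal (enc c))
  exists_enabled {c c'} : I c → c' ∈ f c → ∃ t, S.Enabled t (toReal (enc c))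
  halted_iff {c} : I c → ((∀ q ∈ H, q.Holds (toReal (enc c))) ↔ f c = none)

namespace Simulates

variable {σ : Type*} {f : σ → Option σ} {enc : σ → Fin m → ℚ} {I : σ → Prop}
  {H : List (Ineq (Fin m))} (hS : S.Simulates f enc I H) {c : σ}
include hS

theorem iterate_mem (hc : I c) (n : ℕ) : I ((fun c => (f c).getD c)^[n] c) := by
  induction n with
  | zero => exact hc
  | succ n ih =>
    rw [Function.iterate_succ_apply']
    cases hf : f ((fun c => (f c).getD c)^[n] c) with
    | none => exact ih
    | some c' => exact hS.mem_of_mem_step ih hf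

theorem toReal_enc_getD (hc : I c) {t : T} (ht : S.Enabled t (toReal (enc c))) :
    toReal (enc ((f c).getD c)) = S.apply t (toReal (enc c)) := by
  obtain ⟨c', hc', henc⟩ := hS.step_of_enabled hc ht
  rw [hc', Option.getD_some, henc]

theorem eq_iterate_of_reach (hc : I c) {n : ℕ} {y : Fin m → ℝ}
    (hy : S.Reach (toReal (enc c)) n y) :
    y = toReal (enc ((fun c => (f c).getD c)^[n] c)) ∧
      ∀ k < n, f ((fun c => (f c).getD c)^[k] c) ≠ none := by
  induction hy with
  | zero => exact ⟨rfl, fun k hk => absurd hk k.not_lt_zero⟩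
  | @succ n _ t _ ht ih =>
    obtain ⟨rfl, hlt⟩ := ih
    have hn := hS.iterate_mem hc n
    refine ⟨?_, Nat.forall_lt_succ_right.2 ⟨hlt, ?_⟩⟩
    · rw [Function.iterate_succ_apply', hS.toReal_enc_getD hn ht]
    · obtain ⟨c', hc', -⟩ := hS.step_of_enabled hn ht
      exact Option.ne_none_iff_exists'.2 ⟨c', hc'⟩

theorem exists_isRun [Nonempty T] (hc : I c) : ∃ t : ℕ → T, ∀ N,
    (∀ n < N, f ((fun c => (f c).getD c)^[n] c) ≠ none) →
      S.IsRun t (fun n => toReal (enc ((fun c => (f c).getD c)^[n] c))) N := by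
  have exists_map (n : ℕ) : ∃ t : T, f ((fun c => (f c).getD c)^[n] c) ≠ none →
      S.Enabled t (toReal (enc ((fun c => (f c).getD c)^[n] c))) := by
    cases hf : f ((fun c => (f c).getD c)^[n] c) with
    | none => exact ⟨Classical.arbitrary T, fun h => absurd rfl h⟩
    | some c' =>
      obtain ⟨t, ht⟩ := hS.exists_enabled (hS.iterate_mem hc n) hf
      exact ⟨t, fun _ => ht⟩
  choose t ht using exists_map
  refine ⟨t, fun N hN n hn => ⟨ht n (hN n hn), ?_⟩⟩
  simp only [Function.iterate_succ_apply']
  exact hS.toReal_enc_getD (hS.iterate_mem hc n) (ht n (hN n hn))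

variable [Fintype T] [DecidableEq T] [Nonempty T]

theorem answer_safety_iff (hc : I c) :
    (S.input (enc c) S.safetyFormula).Answer ↔ ¬(StateTransition.eval f c).Dom := by
  rw [eval_dom_iff_exists_iterate_eq_none, not_exists]
  refine ⟨fun h N => ?_, fun h => ?_⟩
  · obtain ⟨n, hn, y, hy⟩ := exists_reach_of_answer_safety h (N + 1)
    exact (hS.eq_iterate_of_reach hc hy).2 N hn
  · obtain ⟨t, ht⟩ := hS.exists_isRun hc
    exact answer_of_runPath_sat (fun n => hS.isSmall (hS.iterate_mem hc n)) rfl fun hM =>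
      runPath_sat_safetyFormula _ hM fun N => ht N fun n _ => h n

theorem answer_reach_iff (hc : I c) :
    (S.input (enc c) (S.reachFormula H)).Answer ↔ (StateTransition.eval f c).Dom := by
  classical
  rw [eval_dom_iff_exists_iterate_eq_none]
  refine ⟨fun h => ?_, fun h => ?_⟩
  · obtain ⟨n, y, hy, hH⟩ := exists_reach_of_answer_reach h
    rw [(hS.eq_iterate_of_reach hc hy).1] at hH
    exact ⟨n, (hS.halted_iff (hS.iterate_mem hc n)).1 hH⟩
  · obtain ⟨t, ht⟩ := hS.exists_isRun hc
    exact answer_of_runPath_sat (fun n => hS.isSmall (hS.iterate_mem hc n)) rfl fun hM =>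
      runPath_sat_reachFormula _ hM (ht _ fun n hn => Nat.find_min h hn)
        ((hS.halted_iff (hS.iterate_mem hc _)).2 (Nat.find_spec h))

end Simulates

end AffineSystem

/-! ### Turing machines as systems of affine maps -/

section HalfTape

open Turing

/-- The base of the numeral system in which the half-tapes of a Turing machine are written. -/
def tapeBase (Γ : Type*) [Fintype Γ] : ℕ := 2 * Fintype.card Γ + 3

theorem tapeBase_pos {Γ : Type*} [Fintype Γ] : 0 < tapeBase Γ := by
  simp [tapeBase]

variable {Γ : Type*} [Inhabited Γ] [Fintype Γ] [DecidableEq Γ] (s : Γ)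

/-- The digit of a symbol in base `tapeBase Γ`. The digits are even, so that a digit can be
recognized by non-strict inequalities. The blank has the greatest digit, so that the number with
only this digit is `1`, and `s` has the digit `0`, so that appending `s` to the left of a number is
a division. -/
noncomputable def digit (a : Γ) : ℕ :=
  if a = s then 0 else if a = default then 2 * (Fintype.card Γ + 1)
  else 2 * ((Fintype.equivFin Γ a : ℕ) + 1)

/-- The number in `(0, 1]` whose digits are given by a list, followed by infinitely many blanks. -/
noncomputable def listValue (l : List Γ) : ℚ :=
  l.foldr (fun a x => (digit s a + x) / tapeBase Γ) 1

variable {s}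

theorem two_dvd_digit (a : Γ) : 2 ∣ digit s a := by
  unfold digit
  split_ifs <;> simp

theorem digit_injective : Function.Injective (digit s) := by
  intro a b hab
  have lt_card_a := (Fintype.equivFin Γ a).isLt
  have lt_card_b := (Fintype.equivFin Γ b).isLt
  unfold digit at hab
  split_ifs at hab
  all_goals first | omega | (subst_vars; rfl) | skip
  exact (Fintype.equivFin Γ).injective (Fin.ext (by omega))

theorem digit_lt_tapeBase (a : Γ) : digit s a < tapeBase Γ := by
  have lt_card := (Fintype.equivFin Γ a).isLt
  unfold digit tapeBase
  split_ifs <;> omega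

theorem digit_default_add_one (hs : s ≠ default) : digit s default + 1 = tapeBase Γ := by
  simp only [digit, hs.symm, if_false, if_true, tapeBase]
  ring

theorem listValue_cons (a : Γ) (l : List Γ) :
    listValue s (a :: l) = (digit s a + listValue s l) / tapeBase Γ := rfl

theorem listValue_pos (l : List Γ) : 0 < listValue s l := by
  induction l with
  | nil => exact one_pos
  | cons a l ih => exact div_pos (by positivity) (by exact_mod_cast tapeBase_pos)

theorem listValue_le_one (l : List Γ) : listValue s l ≤ 1 := by
  induction l with
  | nil => exact le_rfl
  | cons a l ih =>
    have digit_add_one_le : (digit s a + 1 : ℚ) ≤ tapeBase Γ := by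
      exact_mod_cast digit_lt_tapeBase a
    rw [listValue_cons, div_le_one (by exact_mod_cast tapeBase_pos)]
    linarith

theorem listValue_append_replicate_default (hs : s ≠ default) (l : List Γ) (n : ℕ) :
    listValue s (l ++ List.replicate n default) = listValue s l := by
  induction l with
  | nil =>
    induction n with
    | zero => rfl
    | succ n ih =>
      rw [List.nil_append] at ih
      rw [List.nil_append, List.replicate_succ, listValue_cons, ih, listValue, List.foldr_nil,
        ← digit_default_add_one hs, Nat.cast_add_one, div_self (by positivity)]
  | cons a l ih => rw [List.cons_append, listValue_cons, listValue_cons, ih]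

theorem listValue_replicate_self (n : ℕ) :
    listValue s (List.replicate n s) = ((tapeBase Γ ^ n : ℕ) : ℚ)⁻¹ := by
  induction n with
  | zero => simp [listValue]
  | succ n ih =>
    rw [List.replicate_succ, listValue_cons, ih, digit, if_pos rfl, Nat.cast_zero, zero_add,
      pow_succ, Nat.cast_mul, mul_inv, div_eq_mul_inv]

/-- The number in `(0, 1]` whose digits are given by a half-tape. -/
noncomputable def tapeValue (hs : s ≠ default) (L : ListBlank Γ) : ℚ :=
  L.liftOn (listValue s) fun a b hab => by
    obtain ⟨n, rfl⟩ := hab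
    exact (listValue_append_replicate_default hs a n).symm

variable (hs : s ≠ default)

theorem tapeValue_mk (l : List Γ) : tapeValue hs (ListBlank.mk l) = listValue s l := rfl

theorem tapeValue_cons (a : Γ) (L : ListBlank Γ) :
    tapeValue hs (L.cons a) = (digit s a + tapeValue hs L) / tapeBase Γ := by
  induction L using ListBlank.induction_on
  rw [ListBlank.cons_mk, tapeValue_mk, tapeValue_mk, listValue_cons]

theorem tapeBase_mul_tapeValue (L : ListBlank Γ) :
    tapeBase Γ * tapeValue hs L = digit s L.head + tapeValue hs L.tail := by
  conv_lhs => rw [← ListBlank.cons_head_tail L, tapeValue_cons]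
  exact mul_div_cancel₀ _ (by exact_mod_cast tapeBase_pos.ne')

theorem tapeValue_pos (L : ListBlank Γ) : 0 < tapeValue hs L := by
  induction L using ListBlank.induction_on
  exact listValue_pos _

theorem tapeValue_le_one (L : ListBlank Γ) : tapeValue hs L ≤ 1 := by
  induction L using ListBlank.induction_on
  exact listValue_le_one _

theorem head_eq_iff (L : ListBlank Γ) (b : Γ) :
    L.head = b ↔ (digit s b : ℚ) ≤ tapeBase Γ * tapeValue hs L ∧
      tapeBase Γ * tapeValue hs L ≤ digit s b + 1 := by
  have tail_pos := tapeValue_pos hs L.tail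
  have tail_le_one := tapeValue_le_one hs L.tail
  rw [tapeBase_mul_tapeValue]
  constructor
  · rintro rfl
    constructor <;> linarith
  · rintro ⟨hle, hge⟩
    have le_add_one : (digit s b : ℚ) ≤ digit s L.head + 1 := by linarith
    have lt_add_one : (digit s L.head : ℚ) < digit s b + 1 := by linarith
    have le_add_one' : digit s b ≤ digit s L.head + 1 := by exact_mod_cast le_add_one
    have lt_add_one' : digit s L.head < digit s b + 1 := by exact_mod_cast lt_add_one
    have even_digit_head := two_dvd_digit (s := s) L.head
    have even_digit := two_dvd_digit (s := s) b
    exact digit_injective (s := s) (by omega)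

/-- The inequalities which express that the first digit of the coordinate `i` is the digit of
`b`. -/
noncomputable def headIneqs (s : Γ) {m : ℕ} (i : Fin m) (b : Γ) : List (Ineq (Fin m)) :=
  [⟨Pi.single i (-tapeBase Γ), -digit s b⟩, ⟨Pi.single i (tapeBase Γ), digit s b + 1⟩]

theorem forall_mem_headIneqs {m : ℕ} {i : Fin m} {x : Fin m → ℝ} {L : ListBlank Γ}
    (hx : x i = tapeValue hs L) (b : Γ) :
    (∀ q ∈ headIneqs s i b, q.Holds x) ↔ L.head = b := by
  have toReal_iff : ((digit s b : ℝ) ≤ tapeBase Γ * tapeValue hs L ∧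
      tapeBase Γ * (tapeValue hs L : ℝ) ≤ digit s b + 1) ↔ L.head = b := by
    rw [head_eq_iff hs]
    norm_cast
  rw [← toReal_iff]
  simp [headIneqs, Ineq.Holds, Ineq.sum_single_mul, hx]

end HalfTape

open Turing

section StateNumber

variable {Γ Λ : Type*} [Fintype Γ] [Inhabited Λ] (M : TM0.Machine Γ Λ) (S : Finset Λ)

open Classical in
/-- A positive number for a state and the symbol under the head: it is determined by its number if
the machine makes a step, and it is the greatest number if the machine halts. -/
noncomputable def stateNumber (q : Λ) (a : Γ) : ℕ :=
  if h : q ∈ S ∧ (M q a).isSome then (Fintype.equivFin (S × Γ) (⟨q, h.1⟩, a) : ℕ) + 1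
  else Fintype.card (S × Γ) + 1

theorem stateNumber_pos (q : Λ) (a : Γ) : 0 < stateNumber M S q a := by
  unfold stateNumber
  split_ifs <;> exact Nat.succ_pos _

theorem stateNumber_le (q : Λ) (a : Γ) : stateNumber M S q a ≤ Fintype.card (S × Γ) + 1 := by
  unfold stateNumber
  split_ifs
  exacts [Nat.succ_le_succ (Fin.is_lt _).le, le_rfl]

variable {M S} {q q' : Λ} {a a' : Γ}

theorem card_lt_stateNumber_iff (hq : q ∈ S) :
    Fintype.card (S × Γ) < stateNumber M S q a ↔ M q a = none := by
  rw [← Option.not_isSome_iff_eq_none]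
  unfold stateNumber
  split_ifs with hstep
  · simpa only [hstep.2, not_true_eq_false, iff_false, not_lt] using Nat.succ_le_of_lt (Fin.is_lt _)
  · simpa only [Nat.lt_succ_self, true_iff] using fun h => hstep ⟨hq, h⟩

theorem stateNumber_eq_iff (hq : q ∈ S) (hstep : (M q a).isSome) :
    stateNumber M S q' a' = stateNumber M S q a ↔ q' = q ∧ a' = a := by
  refine ⟨fun h => ?_, fun ⟨hq', ha'⟩ => by rw [hq', ha']⟩
  have lt_card := (Fintype.equivFin (S × Γ) (⟨q, hq⟩, a)).isLt
  have number_eq : stateNumber M S q a = Fintype.equivFin (S × Γ) (⟨q, hq⟩, a) + 1 :=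
    dif_pos ⟨hq, hstep⟩
  rw [number_eq] at h
  unfold stateNumber at h
  split_ifs at h
  · simpa using (Fintype.equivFin (S × Γ)).injective (Fin.ext (Nat.succ_injective h))
  · omega

end StateNumber

namespace AffineSystem

variable {Γ Λ : Type*} [Inhabited Γ] [Fintype Γ] [DecidableEq Γ] [Inhabited Λ]
  (M : TM0.Machine Γ Λ) (S : Finset Λ)

namespace ofTM0

variable (s : Γ)

/-- The guard of the map for a state, the symbol under the head, and the symbol to which the head
moves. If the machine halts, there is no step and the guard is the inequality `0 ≤ -1`. -/
noncomputable def guard (t : S × Γ × Γ) : List (Ineq (Fin 3)) :=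
  match M t.1 t.2.1 with
  | none => [⟨0, -1⟩]
  | some (_, stmt) =>
    [Ineq.le 0 (stateNumber M S t.1 t.2.1), Ineq.ge 0 (stateNumber M S t.1 t.2.1)] ++
      match stmt with
      | .move .left => headIneqs s 1 t.2.2
      | .move .right => headIneqs s 2 t.2.2
      | .write _ => []

/-- The factors by which the coordinates are multiplied in a step. A move removes a digit from one
half-tape and adds one to the other. -/
noncomputable def factor (t : S × Γ × Γ) : Fin 3 → ℚ :=
  match M t.1 t.2.1 with
  | none => 0
  | some (_, .move .left) => ![0, tapeBase Γ, (tapeBase Γ : ℚ)⁻¹]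
  | some (_, .move .right) => ![0, (tapeBase Γ : ℚ)⁻¹, tapeBase Γ]
  | some (_, .write _) => ![0, 1, 1]

/-- The constants that are added to the coordinates in a step. -/
noncomputable def shift (t : S × Γ × Γ) : Fin 3 → ℚ :=
  match M t.1 t.2.1 with
  | none => 0
  | some (q, .move .left) =>
    ![stateNumber M S q t.2.2, -digit s t.2.2, digit s t.2.1 / tapeBase Γ]
  | some (q, .move .right) =>
    ![stateNumber M S q t.2.2, digit s t.2.1 / tapeBase Γ, -digit s t.2.2]
  | some (q, .write b) => ![stateNumber M S q b, 0, 0]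

end ofTM0

/-- The system of affine maps of `ℝ³` that simulates a Turing machine with states in `S`. -/
noncomputable def ofTM0 (s : Γ) : AffineSystem 3 (S × Γ × Γ) where
  guard := ofTM0.guard M S s
  linear t := .diagonal (ofTM0.factor M S t)
  const := ofTM0.shift M S s
  capacity := Fintype.card (S × Γ) + 4

namespace ofTM0

variable {s : Γ} (hs : s ≠ default)

/-- The point that represents a configuration. -/
noncomputable def point (c : TM0.Cfg Γ Λ) : Fin 3 → ℚ :=
  ![stateNumber M S c.q c.Tape.head, tapeValue hs c.Tape.left, tapeValue hs c.Tape.right]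

/-- The condition that the represented configuration has no successor. -/
def halted (Γ : Type*) [Fintype Γ] {Λ : Type*} (S : Finset Λ) : List (Ineq (Fin 3)) :=
  [Ineq.ge 0 (Fintype.card (S × Γ) + 1)]

theorem apply_toReal (t : S × Γ × Γ) (x : Fin 3 → ℚ) :
    (ofTM0 M S s).apply t (toReal x) = toReal (factor M S t * x + shift M S s t) := by
  funext i
  simp [AffineSystem.apply, ofTM0, affineImage, toReal, Matrix.diagonal_apply,
    apply_ite (Rat.cast : ℚ → ℝ)]

theorem isSmall_point (c : TM0.Cfg Γ Λ) :
    IsSmall (ofTM0 M S s).capacity (toReal (point M S hs c)) := by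
  have number_pos := stateNumber_pos M S c.q c.Tape.head
  have number_le : (stateNumber M S c.q c.Tape.head : ℚ) ≤ (Fintype.card (S × Γ) + 1 : ℕ) :=
    Nat.cast_le.2 (stateNumber_le M S c.q c.Tape.head)
  have left_le := tapeValue_le_one hs c.Tape.left
  have right_le := tapeValue_le_one hs c.Tape.right
  constructor
  · rw [Fin.forall_fin_succ, Fin.forall_fin_two]
    refine ⟨?_, ?_, ?_⟩ <;> refine Rat.cast_pos.2 ?_
    exacts [Nat.cast_pos.2 number_pos, tapeValue_pos hs _, tapeValue_pos hs _]
  · have sum_lt : ∑ i, point M S hs c i < ((ofTM0 M S s).capacity : ℕ) := by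
      simp only [Fin.sum_univ_three, point, ofTM0, Matrix.cons_val]
      push_cast at number_le ⊢
      linarith
    simp only [toReal]
    exact_mod_cast sum_lt

theorem toReal_point_zero (c : TM0.Cfg Γ Λ) :
    toReal (point M S hs c) 0 = stateNumber M S c.q c.Tape.head :=
  Rat.cast_natCast _

theorem holds_le_and_ge_stateNumber {q : Λ} {a : Γ} (hq : q ∈ S) (hstep : (M q a).isSome)
    (c : TM0.Cfg Γ Λ) :
    (∀ p ∈ [Ineq.le 0 (stateNumber M S q a), Ineq.ge 0 (stateNumber M S q a)],
      p.Holds (toReal (point M S hs c))) ↔ c.q = q ∧ c.Tape.head = a := by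
  rw [← stateNumber_eq_iff hq hstep, List.forall_mem_cons, List.forall_mem_singleton,
    Ineq.holds_le, Ineq.holds_ge, toReal_point_zero, le_antisymm_iff]
  norm_cast

theorem enabled_iff (t : S × Γ × Γ) (c : TM0.Cfg Γ Λ) :
    (ofTM0 M S s).Enabled t (toReal (point M S hs c)) ↔
      ∃ p ∈ M t.1 t.2.1, (c.q = t.1 ∧ c.Tape.head = t.2.1) ∧
        match p.2 with
        | .move .left => c.Tape.left.head = t.2.2
        | .move .right => c.Tape.right.head = t.2.2
        | .write _ => True := by
  change (∀ q ∈ guard M S s t, _) ↔ _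
  unfold guard
  rcases hM : M t.1 t.2.1 with _ | ⟨q, stmt⟩
  · simp [Ineq.Holds]
  · simp only [Option.mem_def, Option.some.injEq, exists_eq_left']
    rw [List.forall_mem_append,
      holds_le_and_ge_stateNumber M S hs t.1.2 (Option.isSome_of_eq_some hM)]
    refine and_congr_right fun _ => ?_
    rcases stmt with (_ | _) | b
    · exact forall_mem_headIneqs hs (L := c.Tape.left) rfl t.2.2
    · exact forall_mem_headIneqs hs (L := c.Tape.right) rfl t.2.2
    · simp

section Step

variable {t : S × Γ × Γ} {q' : Λ} {c : TM0.Cfg Γ Λ}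

theorem point_move_left (hstep : M t.1 t.2.1 = some (q', .move .left))
    (hhead : c.Tape.head = t.2.1) (hleft : c.Tape.left.head = t.2.2) :
    point M S hs ⟨q', c.Tape.move .left⟩ = factor M S t * point M S hs c + shift M S s t := by
  have pop := tapeBase_mul_tapeValue hs c.Tape.left
  have push := tapeValue_cons hs c.Tape.head c.Tape.right
  rw [hleft] at pop
  rw [hhead] at push
  funext i
  fin_cases i
  · simp [point, factor, shift, hstep, Tape.move, hleft]
  · simp [point, factor, shift, hstep, Tape.move, pop]
  · simp only [point, factor, shift, hstep, Tape.move, hhead, push, Fin.reduceFinMk, Pi.add_apply,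
      Pi.mul_apply, Matrix.cons_val]
    ring

theorem point_move_right (hstep : M t.1 t.2.1 = some (q', .move .right))
    (hhead : c.Tape.head = t.2.1) (hright : c.Tape.right.head = t.2.2) :
    point M S hs ⟨q', c.Tape.move .right⟩ = factor M S t * point M S hs c + shift M S s t := by
  have pop := tapeBase_mul_tapeValue hs c.Tape.right
  have push := tapeValue_cons hs c.Tape.head c.Tape.left
  rw [hright] at pop
  rw [hhead] at push
  funext i
  fin_cases i
  · simp [point, factor, shift, hstep, Tape.move, hright]
  · simp only [point, factor, shift, hstep, Tape.move, hhead, push, Fin.mk_one, Pi.add_apply,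
      Pi.mul_apply, Matrix.cons_val]
    ring
  · simp [point, factor, shift, hstep, Tape.move, pop]

theorem point_write {b : Γ} (hstep : M t.1 t.2.1 = some (q', .write b)) :
    point M S hs ⟨q', c.Tape.write b⟩ = factor M S t * point M S hs c + shift M S s t := by
  funext i
  fin_cases i <;> simp [point, factor, shift, hstep, Tape.write]

theorem exists_mem_step_of_enabled (ht : (ofTM0 M S s).Enabled t (toReal (point M S hs c))) :
    ∃ c' ∈ TM0.step M c,
      toReal (point M S hs c') = (ofTM0 M S s).apply t (toReal (point M S hs c)) := by
  obtain ⟨⟨q', stmt⟩, hstep, ⟨hq, hhead⟩, hnext⟩ := (enabled_iff M S hs t c).1 ht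
  simp only [apply_toReal, TM0.step, hq, hhead, Option.mem_def.1 hstep, Option.map_some,
    Option.mem_def, Option.some.injEq, exists_eq_left']
  congr 1
  rcases stmt with (_ | _) | b
  exacts [point_move_left M S hs hstep hhead hnext, point_move_right M S hs hstep hhead hnext,
    point_write M S hs hstep]

end Step

theorem exists_enabled {c c' : TM0.Cfg Γ Λ} (hc : c.q ∈ S) (hc' : c' ∈ TM0.step M c) :
    ∃ t, (ofTM0 M S s).Enabled t (toReal (point M S hs c)) := by
  obtain ⟨⟨q', stmt⟩, hstep, -⟩ := Option.mem_map.1 hc'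
  obtain ⟨b, hb⟩ : ∃ b, match stmt with
      | .move .left => c.Tape.left.head = b
      | .move .right => c.Tape.right.head = b
      | .write _ => True := by
    rcases stmt with (_ | _) | b
    exacts [⟨_, rfl⟩, ⟨_, rfl⟩, ⟨b, trivial⟩]
  exact ⟨(⟨c.q, hc⟩, c.Tape.head, b),
    (enabled_iff M S hs _ c).2 ⟨(q', stmt), hstep, ⟨rfl, rfl⟩, hb⟩⟩

theorem holds_halted_iff {c : TM0.Cfg Γ Λ} (hc : c.q ∈ S) :
    (∀ p ∈ halted Γ S, p.Holds (toReal (point M S hs c))) ↔ TM0.step M c = none := by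
  rw [TM0.step, Option.map_eq_none_iff, ← card_lt_stateNumber_iff hc, halted,
    List.forall_mem_singleton, Ineq.holds_ge, toReal_point_zero]
  norm_cast

theorem simulates (hS : TM0.Supports M ↑S) :
    (ofTM0 M S s).Simulates (TM0.step M) (point M S hs) (fun c => c.q ∈ S) (halted Γ S) where
  mem_of_mem_step hc hc' := Finset.mem_coe.1 (TM0.step_supports M hS hc' (Finset.mem_coe.2 hc))
  isSmall _ := isSmall_point M S hs _
  step_of_enabled _ := exists_mem_step_of_enabled M S hs
  exists_enabled := exists_enabled M S hs
  halted_iff := holds_halted_iff M S hs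

theorem point_init (a : Γ) (n : ℕ) :
    point M S hs (TM0.init (a :: List.replicate n s)) =
      ![(stateNumber M S default a : ℚ), 1, ((tapeBase Γ ^ n : ℕ) : ℚ)⁻¹] := by
  rw [← listValue_replicate_self (s := s)]
  rfl

end ofTM0

end AffineSystem

/-! ### The reduction from the halting problem -/

section Reduction

open Turing

theorem computable_num_den_const {α : Type*} [Primcodable α] (q : ℚ) :
    Computable fun _ : α => (q.num, q.den) :=
  Computable.const _

theorem computable_num_den_inv_pow {b : ℕ} (hb : 0 < b) :
    Computable fun n : ℕ => ((((b ^ n : ℕ) : ℚ)⁻¹).num, (((b ^ n : ℕ) : ℚ)⁻¹).den) :=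
  ((Computable.const (1 : ℤ)).pair (computable_pow b)).of_eq fun n => by
    rw [Rat.inv_natCast_num_of_pos (pow_pos hb n), Rat.inv_natCast_den_of_pos (pow_pos hb n)]

theorem AffineSystem.start_coord {m : ℕ} {T : Type*} [Fintype T] [DecidableEq T]
    (S : AffineSystem m T) (x : Fin m → ℚ) (p : Coord m T) : S.start x (S.graph.coord p) =
      Sum.elim (Pi.single .first 1) (fun p => if p.1 = false then x p.2 else 0) p :=
  congrArg _ (S.graph.coord.symm_apply_apply p)

theorem AffineSystem.computable_code_input {α : Type*} [Primcodable α] {m : ℕ} {T : Type*}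
    [Fintype T] [DecidableEq T] (S : AffineSystem m T) {x : α → Fin m → ℚ}
    (hx : ∀ i, Computable fun a => ((x a i).num, (x a i).den))
    (φ : LTL (Fintype.card (Coord m T))) : Computable fun a => (S.input (x a) φ).code := by
  have computable_start : Computable fun a => vecCode (S.start (x a)) := by
    refine Computable.list_ofFn fun i => ?_
    obtain ⟨p, rfl⟩ := S.graph.coord.surjective i
    simp only [start_coord]
    rcases p with v | ⟨_ | _, j⟩
    exacts [computable_num_den_const _, hx j, computable_num_den_const 0]
  exact (Computable.const ((S.input 0 φ).modes.map vecCode)).pair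
    (computable_start.pair (Computable.const φ.code))

theorem AffineSystem.ofTM0.computable_num_den_point_init {Γ Λ : Type*} [Inhabited Γ] [Fintype Γ]
    [DecidableEq Γ] [Inhabited Λ] (M : TM0.Machine Γ Λ) (S : Finset Λ) {s : Γ} (hs : s ≠ default)
    (a : Γ) (i : Fin 3) : Computable fun n =>
      ((point M S hs (TM0.init (a :: List.replicate n s)) i).num,
        (point M S hs (TM0.init (a :: List.replicate n s)) i).den) := by
  simp only [point_init]
  fin_cases i
  exacts [computable_num_den_const _, computable_num_den_const 1,
    computable_num_den_inv_pow tapeBase_pos]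

theorem not_modelCheckingDecidable_of_reduction {X : Set Op} {p : ℕ → Prop}
    (hp : ¬ComputablePred p) {I : ℕ → MCInput} (hmem : ∀ n, (I n).formula ∈ LTL.fragmentB (I n).d X)
    (hcode : Computable fun n => (I n).code) (hanswer : ∀ n, (I n).Answer ↔ p n) :
    ¬ModelCheckingDecidable X := by
  rintro ⟨q, hq, hcorrect⟩
  refine hp ((ComputablePred.computable_of_manyOneReducible (ManyOneReducible.mk _ hcode) hq).of_eq
    fun n => ?_)
  rw [hcorrect _ (hmem n), hanswer]

end Reduction

end MultiMode

theorem mainTheorem6 :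
    ¬ MultiMode.ModelCheckingDecidable {MultiMode.Op.U} ∧
      ¬ MultiMode.ModelCheckingDecidable {MultiMode.Op.G, MultiMode.Op.or} := by
  classical
  obtain ⟨Γ, Λ, _, _, _, M, S, a, s, hs, hS, hund⟩ := MultiMode.exists_TM0_undecidable
  have _ : Fintype Γ := Fintype.ofFinite Γ
  have default_mem : default ∈ S := Finset.mem_coe.1 hS.1
  have _ : Nonempty (S × Γ × Γ) := ⟨(⟨default, default_mem⟩, a, a)⟩
  have hsim := MultiMode.AffineSystem.ofTM0.simulates M S hs hS
  have computable_code := (MultiMode.AffineSystem.ofTM0 M S s).computable_code_input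
    (MultiMode.AffineSystem.ofTM0.computable_num_den_point_init M S hs a)
  constructor
  · exact MultiMode.not_modelCheckingDecidable_of_reduction hund
      (fun _ => MultiMode.AffineSystem.reachFormula_mem_fragmentB _ _) (computable_code _)
      fun _ => hsim.answer_reach_iff default_mem
  · exact MultiMode.not_modelCheckingDecidable_of_reduction
      (fun hdec => hund (hdec.not.of_eq fun _ => not_not))
      (fun _ => MultiMode.AffineSystem.safetyFormula_mem_fragmentB _) (computable_code _)
      fun _ => hsim.answer_safety_iff default_mem
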